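/- For $\alpha\in\mathbb R$ let $L_n^\alpha(x)=\sum_{j=0}^n\frac{(-x)^j}{j!}\binom{n+\alpha}{n-j}$ denote the Laguerre polynomials. Let $\mathcal F=(F_1,F_2)$ be a pair of finite sets of positive integers, not both empty, let $k_i$ be the number of elements of $F_i$, and put $k=k_1+k_2$, $$u_{\mathcal F}=\sum_{f\in F_1}f+\sum_{f\in F_2}f-\binom{k_1+1}{2}-\binom{k_2}{2},\qquad \sigma_{\mathcal F}=\{u_{\mathcal F},u_{\mathcal F}+1,\dots\}\setminus\{u_{\mathcal F}+f: f\in F_1\}.$$ Let $\Omega_{\mathcal F}^\alpha(x)$ be the determinant of the $k\times k$ matrix whose rows are $\big(L_f^\alpha(x),(L_f^\alpha)'(x),\dots,(L_f^\alpha)^{(k-1)}(x)\big)$ for $f\in F_1$ in increasing order, followed by $\big(L_f^\alpha(-x),L_f^{\alpha+1}(-x),\dots,L_f^{\alpha+k-1}(-x)\big)$ for $f\in F_2$ in increasing order. For $n\in\sigma_{\mathcal F}$ let $L_n^{\alpha;\mathcal F}(x)$ be the determinant of the $(k+1)\times(k+1)$ matrix whose first row is $\big(L_{n-u_{\mathcal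 F}}^\alpha(x),(L_{n-u_{\mathcal F}}^\alpha)'(x),\dots,(L_{n-u_{\mathcal F}}^\alpha)^{(k)}(x)\big)$, followed by the rows $\big(L_f^\alpha(x),\dots,(L_f^\alpha)^{(k)}(x)\big)$, $f\in F_1$, and $\big(L_f^\alpha(-x),L_f^{\alpha+1}(-x),\dots,L_f^{\alpha+k}(-x)\big)$, $f\in F_2$, in the same order. For $c\in\mathbb R\setminus\{0,-1,-2,\dots\}$ put $\hat c=\max\{-\lfloor c\rfloor,0\}$; $c$ and $\mathcal F$ are called admissible if $$\frac{\prod_{f\in F_1}(x-f)\prod_{f\in F_2}(x+c+f)}{(x+c)_{\hat c}}\ge 0\qquad\text{for all } x\in\{0,1,2,\dots\},$$ where $(y)_j=y(y+1)\cdots(y+j-1)$. The polynomials $L_n^{\alpha;\mathcal F}$, $n\in\sigma_{\mathcal F}$, are called exceptional Laguerre polynomials if, for some positive measure $\mu$ on $\mathbb R$ with finite moments of every order, they are pairwise orthogonal in $L^2(\mu)$ with positive norms, and their linear combinations are dense in $L^2(\mu)$. **Theorem.** Let $\alpha\in\mathbb R$, $\alpha\ne-1,-2,\dots$, and let $\mathcal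 F$ be as above. If $\alpha+1$ and $\mathcal F$ are admissible, then $\Omega_{\mathcal F}^\alpha$ has no zero in $(0,\infty)$, so that $$\omega_{\alpha;\mathcal F}(x)=\frac{x^{\alpha+k}e^{-x}}{(\Omega_{\mathcal F}^\alpha(x))^2},\qquad x>0,$$ is a positive weight; it has finite moments of every order; the polynomials $L_n^{\alpha;\mathcal F}$, $n\in\sigma_{\mathcal F}$, are orthogonal with respect to $\omega_{\alpha;\mathcal F}$, with positive norms, that is $\int_0^\infty L_n^{\alpha;\mathcal F}L_m^{\alpha;\mathcal F}\,\omega_{\alpha;\mathcal F}\,dx=0$ for $n\ne m$ and $\int_0^\infty (L_n^{\alpha;\mathcal F})^2\,\omega_{\alpha;\mathcal F}\,dx>0$; and their linear combinations are dense in $L^2((0,\infty),\omega_{\alpha;\mathcal F}(x)\,dx)$. Hence $L_n^{\alpha;\mathcal F}$, $n\in\sigma_{\mathcal F}$, are exceptional Laguerre polynomials. -/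

import Mathlib

open Polynomial MeasureTheory

noncomputable section

namespace ExcLaguerre

/-- The Laguerre polynomial `L_n^α(x) = ∑_{j ≤ n} (-x)^j / j! * binom(n + α, n - j)`, for a real
parameter `α` (generalized binomial coefficient). -/
def laguerre (α : ℝ) (n : ℕ) : ℝ[X] :=
  ∑ j ∈ Finset.range (n + 1),
    C ((-1) ^ j / (j.factorial : ℝ) * Ring.choose ((n : ℝ) + α) (n - j)) * X ^ j

/-- A real number `c` and a pair `(F₁, F₂)` are admissible if
`∏_{f ∈ F₁} (x - f) ∏_{f ∈ F₂} (x + c + f) / (x + c)_ĉ ≥ 0` for all `x ∈ ℕ`, where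
`ĉ = max {-⌊c⌋, 0}` and `(y)_j` is the rising factorial. It is used for `c ≠ 0, -1, -2, …` only,
where the denominator does not vanish. -/
def Admissible (c : ℝ) (F₁ F₂ : Finset ℕ) : Prop :=
  ∀ x : ℕ, 0 ≤ ((∏ f ∈ F₁, ((x : ℝ) - f)) * ∏ f ∈ F₂, ((x : ℝ) + c + f)) /
    (ascPochhammer ℝ (-⌊c⌋).toNat).eval ((x : ℝ) + c)

/-- `u_F = ∑_{f ∈ F₁} f + ∑_{f ∈ F₂} f - binom(k₁ + 1, 2) - binom(k₂, 2)`. For sets of positive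
integers this is nonnegative, so the subtraction in `ℕ` does not truncate. -/
def uIndex (F₁ F₂ : Finset ℕ) : ℕ :=
  (∑ f ∈ F₁, f + ∑ f ∈ F₂, f) - ((F₁.card + 1).choose 2 + F₂.card.choose 2)

/-- `σ_F = {u_F, u_F + 1, …} \ {u_F + f : f ∈ F₁}`. -/
def sigmaSet (F₁ F₂ : Finset ℕ) : Set ℕ :=
  {n | uIndex F₁ F₂ ≤ n ∧ ∀ f ∈ F₁, n ≠ uIndex F₁ F₂ + f}

/-- The row `(L_n^α(x), (L_n^α)'(x), …, (L_n^α)^{(m-1)}(x))`. -/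
def derivRow (α : ℝ) (m n : ℕ) : Fin m → ℝ[X] :=
  fun j => derivative^[(j : ℕ)] (laguerre α n)

/-- The row `(L_f^α(-x), L_f^{α+1}(-x), …, L_f^{α+m-1}(-x))`. -/
def shiftRow (α : ℝ) (m f : ℕ) : Fin m → ℝ[X] :=
  fun j => (laguerre (α + (j : ℕ)) f).comp (-X)

/-- The `k` rows of length `m` given by the elements of `F₁`, in increasing order, followed by
those given by the elements of `F₂`, in increasing order. -/
def pairRows (α : ℝ) (F₁ F₂ : Finset ℕ) (m : ℕ) : Fin (F₁.card + F₂.card) → Fin m → ℝ[X] :=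
  Fin.append (fun i : Fin F₁.card => derivRow α m (F₁.orderEmbOfFin rfl i))
    (fun i : Fin F₂.card => shiftRow α m (F₂.orderEmbOfFin rfl i))

/-- The `k × k` determinant `Ω_F^α`. -/
def Omega (α : ℝ) (F₁ F₂ : Finset ℕ) : ℝ[X] :=
  Matrix.det (Matrix.of (pairRows α F₁ F₂ (F₁.card + F₂.card)))

/-- The `(k + 1) × (k + 1)` determinant `L_n^{α;F}`; it is used for `n ∈ σ_F`, so that
`u_F ≤ n`. -/
def excLaguerre (α : ℝ) (F₁ F₂ : Finset ℕ) (n : ℕ) : ℝ[X] :=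
  Matrix.det (Matrix.of
    (Fin.cons (derivRow α (F₁.card + F₂.card + 1) (n - uIndex F₁ F₂))
      (pairRows α F₁ F₂ (F₁.card + F₂.card + 1)) :
      Fin (F₁.card + F₂.card + 1) → Fin (F₁.card + F₂.card + 1) → ℝ[X]))

/-- The weight `x^{α+k} e^{-x} / Ω_F^α(x)²`, `x > 0`. -/
def weight (α : ℝ) (F₁ F₂ : Finset ℕ) (x : ℝ) : ℝ :=
  x ^ (α + ((F₁.card + F₂.card : ℕ) : ℝ)) * Real.exp (-x) / ((Omega α F₁ F₂).eval x) ^ 2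

/-- The measure with density `weight` with respect to Lebesgue measure on `(0, ∞)`. -/
def weightMeasure (α : ℝ) (F₁ F₂ : Finset ℕ) : Measure ℝ :=
  (volume.restrict (Set.Ioi 0)).withDensity fun x => ENNReal.ofReal (weight α F₁ F₂ x)

/-- The polynomials `p n`, `n ∈ I`, are orthogonal with respect to the positive measure `μ`:
`μ` has finite moments of every order, distinct members are orthogonal, and every member has
positive norm (so that, for instance, the zero measure is excluded). -/
def OrthogonalWrt (μ : Measure ℝ) (I : Set ℕ) (p : ℕ → ℝ[X]) : Prop :=
  (∀ j : ℕ, Integrable (fun x : ℝ => x ^ j) μ) ∧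
  (∀ n ∈ I, ∀ m ∈ I, n ≠ m → ∫ x, (p n).eval x * (p m).eval x ∂μ = 0) ∧
  (∀ n ∈ I, 0 < ∫ x, (p n).eval x ^ 2 ∂μ)

/-- The polynomials `p n`, `n ∈ I`, lie in `L²(μ)` and their linear combinations are dense
there. -/
def CompleteIn (μ : Measure ℝ) (I : Set ℕ) (p : ℕ → ℝ[X]) : Prop :=
  (∀ n ∈ I, MemLp (fun x => (p n).eval x) 2 μ) ∧
  Dense {g : Lp ℝ 2 μ | ∃ q ∈ Submodule.span ℝ (p '' I), (g : ℝ → ℝ) =ᵐ[μ] fun x => q.eval x}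

/-- The polynomials `L_n^{α;F}`, `n ∈ σ_F`, are exceptional Laguerre polynomials: they are
orthogonal and complete with respect to a positive measure. -/
def IsExceptionalLaguerre (α : ℝ) (F₁ F₂ : Finset ℕ) : Prop :=
  ∃ μ : Measure ℝ, OrthogonalWrt μ (sigmaSet F₁ F₂) (excLaguerre α F₁ F₂) ∧
    CompleteIn μ (sigmaSet F₁ F₂) (excLaguerre α F₁ F₂)

end ExcLaguerre

end

/-! The determinants come from a `k`-fold Darboux transformation of the Laguerre operator `L = x ∂²
+ (α + 1 - x) ∂`. The seeds are `L_f^α(x)` for `f ∈ F₁`, with eigenvalue `-f`, and `e^x L_f^α(-x)`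
for `f ∈ F₂`, with eigenvalue `f + α + 1`. Let `T` be the monic operator of order `k` that kills the
seeds. Expansion along the first row gives `L_n^{α;F} = ±Ω T L_{n-u}^α`. The formal adjoint `T*`,
from the weight `x^k w` to `w = x^α e^{-x}`, satisfies `T* T = ∏ (λ_i - L)`, and `T` intertwines `L`
with another second order operator (`DarbouxChain`). These identities are proved in formal power
series at `0`, where possible zeros of `Ω` in `(0, ∞)` do not matter: as `α` is not a negative
integer, the seeds and Wronskians are units and `T*` is injective.

When `α < -1`, integration against `w` is replaced by the functional `Λ : x^n ↦ Γ(α + 1 + n)`, which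
keeps integration by parts and the Laguerre orthogonality. The form `Λ(p T* T q)` is diagonal in the
Laguerre basis, with entries `∏ (λ_i + n) Γ(α + 1 + n) / n!`; admissibility says exactly that they
are nonnegative (`pairNorm_mul_nonneg`). It also forces `α + k > -1`, so that `Λ(x^k ·)` is
integration against `x^{α+k} e^{-x}`.

The heart is the absence of zeros. For each `s` the equation `T* T r = ±T*(Ω s)` has a polynomial
solution, and injectivity of `T*` gives `±Ω T r = Ω² s`. Cauchy-Schwarz for the diagonal form then
bounds `s ↦ ∫ P s x^{α+k} e^{-x}` by the `L²` norm of `Ω s`, for every `P` in the range of `±Ω T`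
(`moment_pairOp_sq_le`). By Riesz and determinacy, `P / Ω` is square integrable. At a zero `x₀ > 0`
of order `m`, `(x - x₀)^m` therefore divides every `P`, hence every coefficient of `±Ω T`. One of
these is `±(Ω' + k₂ Ω)`, but `Ω'` vanishes only to order `m - 1`.

Orthogonality is then the Sturm-Liouville argument, and completeness holds because the range of `±Ω
T` contains all multiples of `Ω²`, which are dense in `L²`. -/

noncomputable section

namespace ExcLaguerre

/-! ### Differential operators and formal adjoints over a ring with a derivation -/

section DifferentialOperators

variable {R : Type*} [CommRing R] [Algebra ℝ R] (D : Derivation ℝ R R) (x : R)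

/-- `x y' + (β - x) y`, which is `x^{1-β} e^x (x^β e^{-x} y)'` when `x' = 1`. -/
def eulerOp (β : ℝ) : R →ₗ[ℝ] R where
  toFun y := x * D y + β • y - x * y
  map_add' y z := by simp only [map_add, smul_add]; ring
  map_smul' r y := by
    simp only [Derivation.map_smul, RingHom.id_apply, mul_smul_comm, smul_add, smul_sub,
      smul_comm β r]

lemma eulerOp_apply (β : ℝ) (y : R) : eulerOp D x β y = x * D y + β • y - x * y := rfl

/-- For `j ≤ k`, the operator `z ↦ w⁻¹ (w x^k z)^{(j)}` with `w = x^α e^{-x}`. -/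
def adjPow (α : ℝ) : ℕ → ℕ → (R →ₗ[ℝ] R)
  | 0, k => LinearMap.mulLeft ℝ (x ^ k)
  | j + 1, k => (adjPow α j (k - 1)).comp (eulerOp D x (α + k))

/-- The differential operator `∑_{j ≤ k} c_j ∂^j`. -/
def diffOp (k : ℕ) (c : ℕ → R) : R →ₗ[ℝ] R :=
  ∑ j ∈ Finset.range (k + 1), (LinearMap.mulLeft ℝ (c j)).comp ((D : R →ₗ[ℝ] R) ^ j)

lemma diffOp_apply (k : ℕ) (c : ℕ → R) (p : R) :
    diffOp D k c p = ∑ j ∈ Finset.range (k + 1), c j * D^[j] p := by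
  simp only [diffOp, LinearMap.sum_apply, LinearMap.comp_apply, LinearMap.mulLeft_apply]
  refine Finset.sum_congr rfl fun j _ => ?_
  rw [Module.End.pow_apply]; rfl

/-- The adjoint of `∑_{j ≤ k} c_j ∂^j` from `x^k w` to `w = x^α e^{-x}`. -/
def adjOp (α : ℝ) (k : ℕ) (c : ℕ → R) : R →ₗ[ℝ] R :=
  ∑ j ∈ Finset.range (k + 1), (-1 : ℝ) ^ j • (adjPow D x α j k).comp (LinearMap.mulLeft ℝ (c j))

lemma adjOp_apply (α : ℝ) (k : ℕ) (c : ℕ → R) (y : R) :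
    adjOp D x α k c y =
      ∑ j ∈ Finset.range (k + 1), (-1 : ℝ) ^ j • adjPow D x α j k (c j * y) := by
  simp [adjOp, LinearMap.sum_apply]

/-- The second order operator `x ∂² + (β - x) ∂ + V`. -/
def secondOp (β : ℝ) (V : R) : R →ₗ[ℝ] R where
  toFun y := x * D (D y) + β • D y - x * D y + V * y
  map_add' y z := by simp only [map_add, smul_add]; ring
  map_smul' r y := by
    simp only [Derivation.map_smul, RingHom.id_apply, mul_smul_comm, smul_add, smul_sub,
      smul_comm β r]

lemma secondOp_apply (β : ℝ) (V y : R) :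
    secondOp D x β V y = x * D (D y) + β • D y - x * D y + V * y := rfl

/-- The product `∏_{i < k} (λ_i - L)` where `L = x ∂² + (α + 1 - x) ∂`. -/
def prodOp (α : ℝ) (lam : ℕ → ℝ) : ℕ → (R →ₗ[ℝ] R)
  | 0 => LinearMap.id
  | k + 1 => (prodOp α lam k).comp (lam k • LinearMap.id - secondOp D x (α + 1) 0)

/-- The coefficients of `(∂ - χ) ∘ ∑ c_j ∂^j`. -/
def stepCoeff (χ : R) (c : ℕ → R) : ℕ → R :=
  fun j => D (c j) + (if j = 0 then 0 else c (j - 1)) - χ * c j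

variable {D x}

/-- As `w x^{k+1} z = w x^k (x z)`, a factor `x` passes from the weight into the argument. The bound
`j ≤ k` keeps the subtraction `k - 1` in `adjPow` from truncating. -/
lemma adjPow_x_mul (hx : D x = 1) (α : ℝ) {j k : ℕ} (hjk : j ≤ k) (z : R) :
    adjPow D x α j (k + 1) z = adjPow D x α j k (x * z) := by
  induction j generalizing k z with
  | zero => simp only [adjPow, LinearMap.mulLeft_apply]; ring
  | succ j ih =>
    obtain ⟨k, rfl⟩ : ∃ k', k = k' + 1 := ⟨k - 1, by omega⟩
    have h : eulerOp D x (α + (k + 1 : ℕ)) (x * z) = x * eulerOp D x (α + (k + 1 + 1 : ℕ)) z := by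
      simp only [eulerOp_apply, Derivation.leibniz, hx, smul_eq_mul, Algebra.smul_def,
        Nat.cast_add, Nat.cast_one, map_add, map_one]
      ring
    simp only [adjPow, LinearMap.comp_apply, Nat.add_sub_cancel, h]
    exact ih (by omega) _

lemma diffOp_step (k : ℕ) (c : ℕ → R) (hc : ∀ j, k < j → c j = 0) (χ p : R) :
    diffOp D (k + 1) (stepCoeff D χ c) p = D (diffOp D k c p) - χ * diffOp D k c p := by
  have h0 : ∀ f : ℕ → R, ∑ j ∈ Finset.range (k + 1 + 1), c j * f j
      = ∑ j ∈ Finset.range (k + 1), c j * f j := by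
    intro f
    rw [Finset.sum_range_succ, hc (k + 1) (by omega), zero_mul, add_zero]
  have h1 : ∑ j ∈ Finset.range (k + 1 + 1), D (c j) * D^[j] p
      = ∑ j ∈ Finset.range (k + 1), D (c j) * D^[j] p := by
    rw [Finset.sum_range_succ, hc (k + 1) (by omega), map_zero, zero_mul, add_zero]
  have h2 : ∑ j ∈ Finset.range (k + 1 + 1), (if j = 0 then 0 else c (j - 1)) * D^[j] p
      = ∑ j ∈ Finset.range (k + 1), c j * D^[j + 1] p := by
    rw [Finset.sum_range_succ']
    simp
  simp only [diffOp_apply, stepCoeff, sub_mul, add_mul, Finset.sum_add_distrib,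
    Finset.sum_sub_distrib, map_sum, Derivation.leibniz, smul_eq_mul, h1, h2]
  simp only [mul_assoc, ← Finset.mul_sum, h0, Function.iterate_succ_apply']
  congr 1
  rw [add_comm]
  congr 1
  exact Finset.sum_congr rfl fun _ _ => mul_comm _ _

/-- Adjoints reverse composition: the adjoint of `∂ - χ` from `x^{k+1} w` to `x^k w` is applied
before that of `∑ c_j ∂^j`. -/
lemma adjOp_step (hx : D x = 1) (α : ℝ) (k : ℕ) (c : ℕ → R) (hc : ∀ j, k < j → c j = 0)
    (χ y : R) :
    adjOp D x α (k + 1) (stepCoeff D χ c) y =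
      adjOp D x α k c (-eulerOp D x (α + (k + 1 : ℕ)) y - x * χ * y) := by
  have h1 : ∑ j ∈ Finset.range (k + 1 + 1),
        (-1 : ℝ) ^ j • adjPow D x α j (k + 1) ((D (c j) - χ * c j) * y)
      = ∑ j ∈ Finset.range (k + 1),
        (-1 : ℝ) ^ j • adjPow D x α j k (x * ((D (c j) - χ * c j) * y)) := by
    rw [Finset.sum_range_succ, hc (k + 1) (by omega), map_zero, mul_zero, sub_zero, zero_mul,
      map_zero, smul_zero, add_zero]
    refine Finset.sum_congr rfl fun j hj => ?_
    rw [adjPow_x_mul hx α (by simp at hj; omega)]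
  have h2 : ∑ j ∈ Finset.range (k + 1 + 1),
        (-1 : ℝ) ^ j • adjPow D x α j (k + 1) ((if j = 0 then 0 else c (j - 1)) * y)
      = ∑ j ∈ Finset.range (k + 1),
        (-1 : ℝ) ^ j • adjPow D x α j k (-eulerOp D x (α + (k + 1 : ℕ)) (c j * y)) := by
    rw [Finset.sum_range_succ']
    simp only [Nat.add_eq_zero_iff, one_ne_zero, and_false, if_false, Nat.add_sub_cancel, if_true,
      zero_mul, map_zero, smul_zero, add_zero]
    refine Finset.sum_congr rfl fun j _ => ?_
    simp only [adjPow, LinearMap.comp_apply, Nat.add_sub_cancel, map_neg, pow_succ]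
    simp
  have h3 : ∀ j, stepCoeff D χ c j * y =
      (D (c j) - χ * c j) * y + (if j = 0 then 0 else c (j - 1)) * y := by
    intro j; simp only [stepCoeff]; ring
  simp only [adjOp_apply, h3, map_add, smul_add, Finset.sum_add_distrib]
  rw [h1, h2, ← Finset.sum_add_distrib]
  refine Finset.sum_congr rfl fun j _ => ?_
  rw [← smul_add, ← map_add]
  congr 2
  simp only [eulerOp_apply, Derivation.leibniz, smul_eq_mul, Algebra.smul_def]
  ring

end DifferentialOperators

/-- As `c k = 1`, replacing the last column by the combination of the columns with weights `c` keeps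
the determinant, and only row `i₀` survives there. -/
lemma det_of_row_relations {R : Type*} [CommRing R] {k : ℕ} (N : Matrix (Fin (k + 1)) (Fin (k + 1)) R)
    (i₀ : Fin (k + 1)) (c : ℕ → R) (hc : c k = 1)
    (h : ∀ i, i ≠ i₀ → ∑ j : Fin (k + 1), c j * N i j = 0) :
    N.det = (-1) ^ ((i₀ : ℕ) + k) * (∑ j : Fin (k + 1), c j * N i₀ j) *
      (N.submatrix i₀.succAbove Fin.castSucc).det := by
  have h1 := Matrix.det_updateCol_sum N (Fin.last k) (fun j => c j)
  simp only [Fin.val_last, hc, smul_eq_mul, one_mul] at h1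
  rw [← h1, Matrix.det_succ_column _ (Fin.last k), Finset.sum_eq_single i₀]
  · simp only [Matrix.updateCol_self, Fin.val_last]
    congr 2
    ext i j
    simp [Matrix.submatrix_apply, Fin.succAbove_last, Matrix.updateCol_ne]
  · intro i _ hi
    simp only [Matrix.updateCol_self]
    rw [h i hi]; simp
  · simp

/-! ### Darboux transformations and Wronskians in formal power series -/

/-- The derivation `d/dX` of the ring of formal power series. -/
abbrev psD : Derivation ℝ (PowerSeries ℝ) (PowerSeries ℝ) := PowerSeries.derivative ℝ

/-- The variable of the ring of formal power series. -/
abbrev psX : PowerSeries ℝ := PowerSeries.X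

/-- The operator with coefficients `c` is the result of `k` Darboux transformations of
`L = x ∂² + (α + 1 - x) ∂` at the eigenfunctions `u_i` with eigenvalues `λ_i`, `i < k`, and the
transformed operator is `x ∂² + (α + 1 + k - x) ∂ + V`. -/
structure DarbouxChain (α : ℝ) (u : ℕ → PowerSeries ℝ) (lam : ℕ → ℝ) (k : ℕ)
    (c : ℕ → PowerSeries ℝ) (V : PowerSeries ℝ) : Prop where
  coeff_of_lt : ∀ j, k < j → c j = 0
  coeff_self : c k = 1
  intertwine : ∀ p, secondOp psD psX (α + 1 + k) V (diffOp psD k c p) =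
    diffOp psD k c (secondOp psD psX (α + 1) 0 p)
  annihilate : ∀ i, i < k → diffOp psD k c (u i) = 0
  factor : ∀ p, adjOp psD psX α k c (diffOp psD k c p) = prodOp psD psX α lam k p
  adj_injective : ∀ y, adjOp psD psX α k c y = 0 → y = 0
  constantCoeff_ne_zero : ∀ (ψ : PowerSeries ℝ) (μ : ℝ),
    secondOp psD psX (α + 1) 0 ψ = μ • ψ → PowerSeries.constantCoeff ψ ≠ 0 →
    (∀ i, i < k → μ ≠ lam i) → PowerSeries.constantCoeff (diffOp psD k c ψ) ≠ 0

/-- A lowest term `a x^n` of a solution satisfies the indicial equation `(n + β) a = 0`. Hence `y`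
is divisible by every power of `x`. -/
lemma eq_zero_of_euler_add_eq_zero {β : ℝ} (hβ : ∀ n : ℕ, (n : ℝ) + β ≠ 0) (χ y : PowerSeries ℝ)
    (h : -eulerOp psD psX β y - psX * χ * y = 0) : y = 0 := by
  have key : ∀ n : ℕ, psX ^ n ∣ y := by
    intro n
    induction n with
    | zero => simp
    | succ n ih =>
      obtain ⟨z, rfl⟩ := ih
      have hd : psX * psD (psX ^ n) = (n : ℝ) • psX ^ n := by
        rw [Derivation.leibniz_pow]
        rcases n with _ | n
        · simp
        · simp only [PowerSeries.derivative_X, smul_eq_mul, mul_one, Nat.add_sub_cancel,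
            nsmul_eq_mul, Algebra.smul_def, map_natCast]
          ring
      have h2 : psX ^ n * (((n : ℝ) + β) • z + psX * (psD z + χ * z - z)) = 0 := by
        have h3 : psX ^ n * (((n : ℝ) + β) • z + psX * (psD z + χ * z - z)) =
            eulerOp psD psX β (psX ^ n * z) + psX * χ * (psX ^ n * z) := by
          rw [eulerOp_apply, Derivation.leibniz, mul_add psX, smul_eq_mul, smul_eq_mul,
            show psX * (z * psD (psX ^ n)) = z * (psX * psD (psX ^ n)) by ring, hd]
          simp only [Algebra.smul_def, map_add]
          ring
        rw [h3]
        linear_combination -h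
      have h4 : ((n : ℝ) + β) • z + psX * (psD z + χ * z - z) = 0 := by
        rcases mul_eq_zero.mp h2 with h | h
        · exact absurd h (pow_ne_zero _ PowerSeries.X_ne_zero)
        · exact h
      have h5 := congrArg PowerSeries.constantCoeff h4
      simp only [map_add, map_mul, PowerSeries.constantCoeff_X, zero_mul, add_zero, map_zero,
        PowerSeries.constantCoeff_smul, smul_eq_mul] at h5
      have h6 : PowerSeries.constantCoeff z = 0 := by
        rcases mul_eq_zero.mp h5 with h | h
        · exact absurd h (hβ n)
        · exact h
      rw [pow_succ]
      exact mul_dvd_mul_left _ (PowerSeries.X_dvd_iff.mpr h6)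
  ext n
  have := (PowerSeries.X_pow_dvd_iff.mp (key (n + 1))) n (by omega)
  simpa using this

lemma darboux_chain_zero (α : ℝ) (u : ℕ → PowerSeries ℝ) (lam : ℕ → ℝ) :
    DarbouxChain α u lam 0 (fun j => if j = 0 then 1 else 0) 0 where
  coeff_of_lt j hj := by simp; omega
  coeff_self := by simp
  intertwine p := by simp [diffOp_apply]
  annihilate i hi := by omega
  factor p := by simp [diffOp_apply, adjOp_apply, adjPow, prodOp]
  adj_injective y hy := by simpa [adjOp_apply, adjPow] using hy
  constantCoeff_ne_zero ψ μ _ h _ := by simpa [diffOp_apply] using h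

/-- With `A = ∂ - φ'/φ` for the transformed seed `φ = T u_k`, and `B` its adjoint, the current
operator factors as `λ_k - B A`. The next one is `λ_k - A B`, so intertwining and factorization
follow formally. -/
lemma DarbouxChain.step {α : ℝ} (hα : ∀ j : ℕ, α ≠ -((j : ℝ) + 1)) {u : ℕ → PowerSeries ℝ}
    {lam : ℕ → ℝ} {k : ℕ} {c : ℕ → PowerSeries ℝ} {V : PowerSeries ℝ}
    (H : DarbouxChain α u lam k c V)
    (hu : secondOp psD psX (α + 1) 0 (u k) = lam k • u k)
    (hu0 : PowerSeries.constantCoeff (diffOp psD k c (u k)) ≠ 0) :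
    ∃ χ V', psD (diffOp psD k c (u k)) = χ * diffOp psD k c (u k) ∧
      DarbouxChain α u lam (k + 1) (stepCoeff psD χ c) V' := by
  set φ := diffOp psD k c (u k) with hφ
  have hinv : φ * φ⁻¹ = 1 := PowerSeries.mul_inv_cancel _ hu0
  have hφne : φ ≠ 0 := fun h => hu0 (by rw [h]; simp)
  set χ := psD φ * φ⁻¹ with hχ
  have hDφ : psD φ = χ * φ := by
    rw [hχ]; linear_combination (-psD φ) * hinv
  set β : ℝ := α + 1 + k with hβ
  have hβne : ∀ n : ℕ, (n : ℝ) + β ≠ 0 := by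
    intro n h
    apply hα (n + k)
    push_cast; linarith
  set b : ℝ → PowerSeries ℝ := fun r => algebraMap ℝ _ r with hb
  have hLφ : secondOp psD psX β V φ = lam k • φ := by
    rw [hφ, H.intertwine, hu, map_smul]
  -- The Riccati equation of `χ = φ'/φ`: the eigenvalue equation of `φ` with the factor `φ`
  -- cancelled.
  have ric : psX * (psD χ + χ * χ) + b β * χ - psX * χ + V = b (lam k) := by
    have h1 : (psX * (psD χ + χ * χ) + b β * χ - psX * χ + V - b (lam k)) * φ = 0 := by
      rw [secondOp_apply, hDφ, Derivation.leibniz, hDφ, smul_eq_mul, smul_eq_mul,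
        Algebra.smul_def, Algebra.smul_def] at hLφ
      linear_combination hLφ
    rcases mul_eq_zero.mp h1 with h | h
    · linear_combination h
    · exact absurd h hφne
  have hba : ∀ ψ, -eulerOp psD psX (α + (k + 1 : ℕ)) (psD ψ - χ * ψ)
      - psX * χ * (psD ψ - χ * ψ) = lam k • ψ - secondOp psD psX β V ψ := by
    intro ψ
    have e : α + (k + 1 : ℕ) = β := by rw [hβ]; push_cast; ring
    rw [e, eulerOp_apply, secondOp_apply, map_sub, Derivation.leibniz, smul_eq_mul,
      smul_eq_mul]
    simp only [Algebra.smul_def]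
    linear_combination ψ * ric
  -- Found by expanding `λ_k - A B`; the first order part is that of parameter `β + 1`.
  set V' : PowerSeries ℝ := b (lam k) - 1 + χ + psX * psD χ - b β * χ + psX * χ - psX * χ * χ
  have hV' : ∀ y, secondOp psD psX (α + 1 + (k + 1 : ℕ)) V' y = lam k • y -
      (psD (-eulerOp psD psX (α + (k + 1 : ℕ)) y - psX * χ * y)
        - χ * (-eulerOp psD psX (α + (k + 1 : ℕ)) y - psX * χ * y)) := by
    intro y
    have e : α + (k + 1 : ℕ) = β := by rw [hβ]; push_cast; ring
    have e' : α + 1 + (k + 1 : ℕ) = β + 1 := by rw [hβ]; push_cast; ring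
    rw [e, e', eulerOp_apply, secondOp_apply]
    simp only [map_sub, map_neg, map_add, Derivation.leibniz, Derivation.map_smul, smul_eq_mul,
      PowerSeries.derivative_X, V', hb]
    simp only [Algebra.smul_def, map_add, map_one]
    ring
  refine ⟨χ, V', hDφ, ?_⟩
  have hstep := fun p => diffOp_step (D := psD) k c H.coeff_of_lt χ p
  have hadj := fun y => adjOp_step (D := psD) (x := psX) (by simp) α k c H.coeff_of_lt χ y
  refine ⟨?_, ?_, ?_, ?_, ?_, ?_, ?_⟩
  · intro j hj
    simp only [stepCoeff]
    rw [H.coeff_of_lt j (by omega), if_neg (by omega), H.coeff_of_lt (j - 1) (by omega)]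
    simp
  · simp only [stepCoeff]
    rw [H.coeff_of_lt (k + 1) (by omega), if_neg (by omega), Nat.add_sub_cancel, H.coeff_self]
    simp
  · intro p
    rw [hV', hstep, hba, hstep, ← H.intertwine, map_sub, Derivation.map_smul]
    simp only [Algebra.smul_def]
    ring
  · intro i hi
    rw [hstep]
    rcases Nat.lt_succ_iff_lt_or_eq.mp hi with h | rfl
    · rw [H.annihilate i h]; simp
    · rw [← hφ, hDφ, sub_self]
  · intro p
    rw [hadj, hstep, hba, H.intertwine, ← map_smul, ← map_sub, H.factor]
    rfl
  · intro y hy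
    rw [hadj] at hy
    refine eq_zero_of_euler_add_eq_zero ?_ χ y (H.adj_injective _ hy)
    intro n h
    apply hβne n
    rw [← h, hβ]; push_cast; ring
  · intro ψ μ hψ h0 hμ
    have hθ := H.constantCoeff_ne_zero ψ μ hψ h0 fun i hi => hμ i (by omega)
    have hLθ : secondOp psD psX β V (diffOp psD k c ψ) = μ • diffOp psD k c ψ := by
      rw [H.intertwine, hψ, map_smul]
    rw [hstep]
    set θ := diffOp psD k c ψ
    have e1 := congrArg PowerSeries.constantCoeff hLθ
    have e2 := congrArg PowerSeries.constantCoeff ric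
    rw [secondOp_apply] at e1
    simp only [map_add, map_sub, map_mul, PowerSeries.constantCoeff_X, zero_mul,
      PowerSeries.constantCoeff_smul, smul_eq_mul, zero_add, sub_zero, hb,
      PowerSeries.algebraMap_apply, PowerSeries.constantCoeff_C, Algebra.algebraMap_self,
      RingHom.id_apply] at e1 e2 ⊢
    intro h
    -- At `0` the equations read `β θ' + V θ = μ θ` and `β χ + V = λ_k`; together they give `β (θ' -
    -- χ θ) = (μ - λ_k) θ`.
    have : (μ - lam k) * PowerSeries.constantCoeff θ = 0 := by
      linear_combination β * h - e1 + e2 * PowerSeries.constantCoeff θ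
    rcases mul_eq_zero.mp this with h | h
    · exact hμ k (by omega) (by linarith)
    · exact hθ h

/-- The matrix of the Wronskian of `u_0, …, u_{k-1}`. -/
def wronskiMatrix (u : ℕ → PowerSeries ℝ) (k : ℕ) : Matrix (Fin k) (Fin k) (PowerSeries ℝ) :=
  Matrix.of fun i j => psD^[j] (u i)

lemma DarbouxChain.wronski_succ {α : ℝ} {u : ℕ → PowerSeries ℝ}
    {lam : ℕ → ℝ} {k : ℕ} {c : ℕ → PowerSeries ℝ} {V : PowerSeries ℝ}
    (H : DarbouxChain α u lam k c V) :
    (wronskiMatrix u (k + 1)).det = diffOp psD k c (u k) * (wronskiMatrix u k).det := by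
  have hs : ∀ p, ∑ j : Fin (k + 1), c j * psD^[j] p = diffOp psD k c p := by
    intro p
    rw [diffOp_apply, Finset.sum_range]
  rw [det_of_row_relations (wronskiMatrix u (k + 1)) (Fin.last k) c H.coeff_self]
  · simp only [wronskiMatrix, Matrix.of_apply, Fin.val_last]
    rw [hs, ← two_mul, pow_mul]
    simp only [even_two, Even.neg_pow, one_pow, one_mul]
    congr 2
    ext i j
    simp [Fin.succAbove_last]
  · intro i hi
    simp only [wronskiMatrix, Matrix.of_apply]
    rw [hs]
    refine H.annihilate _ ?_
    have := i.2
    have : (i : ℕ) ≠ k := fun h => hi (Fin.ext (by simpa using h))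
    omega

lemma DarbouxChain.det_cons {α : ℝ} {u : ℕ → PowerSeries ℝ}
    {lam : ℕ → ℝ} {k : ℕ} {c : ℕ → PowerSeries ℝ} {V : PowerSeries ℝ}
    (H : DarbouxChain α u lam k c V) (v : Fin (k + 1) → PowerSeries ℝ) :
    (Matrix.of (Fin.cons v fun (i : Fin k) (j : Fin (k + 1)) => psD^[j] (u i) :
      Fin (k + 1) → Fin (k + 1) → PowerSeries ℝ)).det =
      (-1) ^ k * (∑ j : Fin (k + 1), c j * v j) * (wronskiMatrix u k).det := by
  rw [det_of_row_relations _ 0 c H.coeff_self]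
  · simp only [Matrix.of_apply, Fin.cons_zero, Fin.val_zero, zero_add]
    congr 2
  · intro i hi
    obtain ⟨i, rfl⟩ := Fin.exists_succ_eq.mpr hi
    simp only [Matrix.of_apply, Fin.cons_succ]
    rw [← Finset.sum_range (fun j => c j * psD^[j] (u i)), ← diffOp_apply]
    exact H.annihilate _ i.2

/-- Existence of the Darboux chain, with the properties of the Wronskian. -/
theorem exists_darbouxChain {α : ℝ} (hα : ∀ j : ℕ, α ≠ -((j : ℝ) + 1)) (u : ℕ → PowerSeries ℝ)
    (lam : ℕ → ℝ) (k : ℕ)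
    (hu : ∀ i, i < k → secondOp psD psX (α + 1) 0 (u i) = lam i • u i)
    (hu0 : ∀ i, i < k → PowerSeries.constantCoeff (u i) ≠ 0)
    (hlam : ∀ i, i < k → ∀ j, j < i → lam i ≠ lam j) :
    ∃ c V, DarbouxChain α u lam k c V ∧
      PowerSeries.constantCoeff (wronskiMatrix u k).det ≠ 0 ∧
      psD (wronskiMatrix u k).det = -(if k = 0 then 0 else c (k - 1)) * (wronskiMatrix u k).det := by
  induction k with
  | zero =>
    refine ⟨_, _, darboux_chain_zero α u lam, ?_, ?_⟩
    · simp
    · simp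
  | succ k ih =>
    obtain ⟨c, V, H, hW, hDW⟩ := ih (fun i hi => hu i (by omega)) (fun i hi => hu0 i (by omega))
      fun i hi => hlam i (by omega)
    have hφ := H.constantCoeff_ne_zero (u k) (lam k) (hu k (by omega)) (hu0 k (by omega))
      (hlam k (by omega))
    obtain ⟨χ, V', hχ, H'⟩ := H.step hα (hu k (by omega)) hφ
    refine ⟨_, V', H', ?_, ?_⟩
    · rw [H.wronski_succ, map_mul]
      exact mul_ne_zero hφ hW
    -- The Wronskian gains the factor `φ`, so its logarithmic derivative gains `χ`, while the
    -- subleading coefficient of `(∂ - χ) ∘ T` loses `χ`.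
    · rw [H.wronski_succ, Derivation.leibniz, hχ, hDW]
      simp only [stepCoeff, H.coeff_self, smul_eq_mul, Nat.add_sub_cancel, if_neg (Nat.succ_ne_zero k),
        Derivation.map_one_eq_zero]
      ring

/-! ### Laguerre polynomials -/

lemma succ_mul_choose_succ (r : ℝ) (m : ℕ) :
    ((m : ℝ) + 1) * Ring.choose r (m + 1) = (r - m) * Ring.choose r m := by
  have h := Ring.choose_smul_choose r (Nat.le_succ m)
  rw [Nat.choose_succ_self_right, Nat.succ_sub (le_refl m), Nat.sub_self, Ring.choose_one_right,
    nsmul_eq_mul] at h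
  push_cast at h
  linarith

lemma choose_ne_zero {r : ℝ} {m : ℕ} (h : ∀ i, i < m → r ≠ i) : Ring.choose r m ≠ 0 := by
  induction m with
  | zero => simp
  | succ m ih =>
    intro h0
    have h1 := succ_mul_choose_succ r m
    rw [h0, mul_zero] at h1
    rcases mul_eq_zero.mp h1.symm with h2 | h2
    · exact h m (by omega) (by linarith)
    · exact ih (fun i hi => h i (by omega)) h2

lemma coeff_laguerre (α : ℝ) (n j : ℕ) : (laguerre α n).coeff j =
    if j ≤ n then (-1) ^ j / (j.factorial : ℝ) * Ring.choose ((n : ℝ) + α) (n - j) else 0 := by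
  simp only [laguerre, finsetSum_coeff, coeff_C_mul, coeff_X_pow, mul_ite, mul_one, mul_zero,
    Finset.sum_ite_eq, Finset.mem_range, Nat.lt_succ_iff]

lemma coeff_laguerre_zero_ne {α : ℝ} (hα : ∀ j : ℕ, α ≠ -((j : ℝ) + 1)) (n : ℕ) :
    (laguerre α n).coeff 0 ≠ 0 := by
  rw [coeff_laguerre, if_pos (Nat.zero_le _)]
  simp only [pow_zero, Nat.factorial_zero, Nat.cast_one, div_one, one_mul, Nat.sub_zero]
  refine choose_ne_zero fun i hi h => hα (n - i - 1) ?_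
  rw [Nat.cast_sub (by omega), Nat.cast_sub (by omega)]
  push_cast; linarith

lemma natDegree_laguerre_le (α : ℝ) (n : ℕ) : (laguerre α n).natDegree ≤ n :=
  natDegree_le_iff_coeff_eq_zero.mpr fun j hj => by
    rw [coeff_laguerre, if_neg (by omega)]

lemma degree_laguerre (α : ℝ) (n : ℕ) : (laguerre α n).degree = n := by
  refine degree_eq_of_le_of_coeff_ne_zero (degree_le_of_natDegree_le (natDegree_laguerre_le α n)) ?_
  rw [coeff_laguerre, if_pos le_rfl]
  simp [Nat.factorial_ne_zero]

lemma laguerre_zero (α : ℝ) : laguerre α 0 = 1 := by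
  simp [laguerre]

lemma derivative_laguerre_succ (α : ℝ) (n : ℕ) :
    derivative (laguerre α (n + 1)) = -laguerre (α + 1) n := by
  ext j
  rw [coeff_derivative, coeff_neg, coeff_laguerre, coeff_laguerre]
  by_cases h : j ≤ n
  · rw [if_pos h, if_pos (by omega), Nat.factorial_succ, Nat.add_sub_add_right]
    have e : ((n + 1 : ℕ) : ℝ) + α = n + (α + 1) := by push_cast; ring
    rw [e]
    have := Nat.cast_ne_zero (R := ℝ).mpr (Nat.factorial_ne_zero j)
    have : (j : ℝ) + 1 ≠ 0 := by positivity
    push_cast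
    field_simp
    ring
  · rw [if_neg h, if_neg (by omega)]; simp

lemma laguerre_sub_derivative (α : ℝ) (n : ℕ) :
    laguerre α n - derivative (laguerre α n) = laguerre (α + 1) n := by
  rcases n with _ | n
  · simp [laguerre_zero]
  rw [derivative_laguerre_succ, sub_neg_eq_add]
  ext j
  rw [coeff_add, coeff_laguerre, coeff_laguerre, coeff_laguerre]
  rcases lt_trichotomy j (n + 1) with h | rfl | h
  · rw [if_pos (by omega), if_pos (by omega), if_pos (by omega),
      show n + 1 - j = (n - j) + 1 by omega,
      show ((n + 1 : ℕ) : ℝ) + (α + 1) = (((n + 1 : ℕ) : ℝ) + α) + 1 by ring,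
      Ring.choose_succ_succ,
      show (n : ℝ) + (α + 1) = ((n + 1 : ℕ) : ℝ) + α by push_cast; ring]
    ring
  · simp
  · rw [if_neg (by omega), if_neg (by omega), if_neg (by omega), add_zero]

/-- The derivation `d/dX` of the ring of polynomials. -/
abbrev polyD : Derivation ℝ ℝ[X] ℝ[X] := Polynomial.derivative'

lemma polyD_apply (p : ℝ[X]) : polyD p = derivative p := rfl

lemma laguerre_ode (α : ℝ) (n : ℕ) :
    secondOp polyD X (α + 1) 0 (laguerre α n) = (-(n : ℝ)) • laguerre α n := by
  -- The differential equation, read on coefficients, is this two-term recursion.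
  have key : ∀ j : ℕ, ((j : ℝ) + 1) * (α + 1 + j) * (laguerre α n).coeff (j + 1) =
      ((j : ℝ) - n) * (laguerre α n).coeff j := by
    intro j
    rw [coeff_laguerre, coeff_laguerre]
    rcases lt_trichotomy j n with h | rfl | h
    · obtain ⟨m, rfl⟩ : ∃ m, n = j + 1 + m := ⟨n - j - 1, by omega⟩
      rw [if_pos (by omega), if_pos (by omega), show j + 1 + m - j = m + 1 by omega,
        show j + 1 + m - (j + 1) = m by omega, Nat.factorial_succ]
      have h1 := succ_mul_choose_succ (((j + 1 + m : ℕ) : ℝ) + α) m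
      have := Nat.cast_ne_zero (R := ℝ).mpr (Nat.factorial_ne_zero j)
      have : (j : ℝ) + 1 ≠ 0 := by positivity
      push_cast at h1 ⊢
      field_simp
      rw [pow_succ]
      linear_combination ((-1 : ℝ) ^ j) * h1
    · simp
    · rw [if_neg (by omega), if_neg (by omega)]; simp
  ext j
  rw [secondOp_apply]
  simp only [polyD_apply, zero_mul, add_zero, coeff_sub, coeff_add, coeff_smul, smul_eq_mul,
    coeff_derivative]
  rcases j with _ | j
  · have := key 0
    simp only [mul_coeff_zero, coeff_X_zero, zero_mul, coeff_derivative]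
    push_cast at this ⊢
    linear_combination this
  · have := key (j + 1)
    simp only [coeff_X_mul, coeff_derivative]
    push_cast at this ⊢
    linear_combination this

/-! ### The moment functional -/

/-- The functional `p ↦ ∫ p(x) x^α e^{-x} dx`, regularized: `x^n ↦ Γ(α + 1 + n)`. -/
def moment (α : ℝ) : ℝ[X] →ₗ[ℝ] ℝ :=
  Polynomial.lsum fun n => LinearMap.mulRight ℝ (Real.Gamma (α + 1 + n))

lemma moment_monomial (α : ℝ) (n : ℕ) (a : ℝ) :
    moment α (monomial n a) = a * Real.Gamma (α + 1 + n) := by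
  simp [moment, lsum_apply, sum_monomial_index]

/-- The argument is `w⁻¹ (x w p)'`, a total derivative. On monomials this is `Γ(s + 1) = s Γ(s)`,
with `s = α + 1 + n ≠ 0`. -/
lemma moment_eulerOp {α : ℝ} (hα : ∀ j : ℕ, α ≠ -((j : ℝ) + 1)) (p : ℝ[X]) :
    moment α (eulerOp polyD X (α + 1) p) = 0 := by
  induction p using Polynomial.induction_on' with
  | add p q hp hq => rw [map_add, map_add, hp, hq, add_zero]
  | monomial n a =>
    have hX : X * derivative (monomial n a) = monomial n (a * n) := by
      rw [derivative_monomial]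
      rcases n with _ | n
      · simp
      · rw [Nat.add_sub_cancel, X_mul_monomial]
    rw [eulerOp_apply, polyD_apply, hX, X_mul_monomial, smul_monomial, map_sub, map_add,
      moment_monomial, moment_monomial, moment_monomial]
    have h : α + 1 + n ≠ 0 := fun h => hα n (by linarith)
    have h2 := Real.Gamma_add_one h
    push_cast
    rw [show α + 1 + ((n : ℝ) + 1) = α + 1 + n + 1 by ring, h2, smul_eq_mul]
    ring

lemma moment_add_one (α : ℝ) (p : ℝ[X]) : moment (α + 1) p = moment α (X * p) := by
  induction p using Polynomial.induction_on' with
  | add p q hp hq => rw [map_add, hp, hq, mul_add, map_add]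
  | monomial n a =>
    rw [X_mul_monomial, moment_monomial, moment_monomial]
    congr 2; push_cast; ring

/-- Integration by parts for the moment functional. -/
lemma moment_derivative_mul {α : ℝ} (hα : ∀ j : ℕ, α ≠ -((j : ℝ) + 1)) (p y : ℝ[X]) (k : ℕ) :
    moment α (derivative p * (X ^ (k + 1) * y)) =
      -moment α (p * (X ^ k * eulerOp polyD X (α + (k + 1 : ℕ)) y)) := by
  rw [eq_neg_iff_add_eq_zero, ← map_add, ← moment_eulerOp hα (p * (X ^ k * y))]
  congr 1
  have hd : X * derivative (X ^ k : ℝ[X]) = (C (k : ℝ)) * X ^ k := by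
    rw [derivative_X_pow]
    rcases k with _ | k
    · simp
    · rw [Nat.add_sub_cancel, pow_succ]; ring
  simp only [eulerOp_apply, polyD_apply, derivative_mul, smul_eq_C_mul, C_add]
  push_cast
  simp only [C_add, C_1]
  linear_combination (-p * y) * hd

lemma moment_iterate_derivative_mul {α : ℝ} (hα : ∀ j : ℕ, α ≠ -((j : ℝ) + 1)) (p y : ℝ[X])
    {j k : ℕ} (hjk : j ≤ k) :
    moment α (derivative^[j] p * (X ^ k * y)) =
      (-1) ^ j * moment α (p * adjPow polyD X α j k y) := by
  induction j generalizing k y with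
  | zero => simp [adjPow]
  | succ j ih =>
    obtain ⟨k, rfl⟩ : ∃ k', k = k' + 1 := ⟨k - 1, by omega⟩
    rw [Function.iterate_succ_apply', moment_derivative_mul hα, ih _ (by omega)]
    simp only [adjPow, LinearMap.comp_apply, Nat.add_sub_cancel]
    ring

/-- Duality between a differential operator and its adjoint. -/
lemma moment_diffOp_mul {α : ℝ} (hα : ∀ j : ℕ, α ≠ -((j : ℝ) + 1)) (k : ℕ) (c : ℕ → ℝ[X])
    (p s : ℝ[X]) :
    moment α (diffOp polyD k c p * (X ^ k * s)) = moment α (p * adjOp polyD X α k c s) := by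
  rw [diffOp_apply, adjOp_apply, Finset.sum_mul, Finset.mul_sum, map_sum, map_sum]
  refine Finset.sum_congr rfl fun j hj => ?_
  have := moment_iterate_derivative_mul hα p (c j * s) (j := j) (k := k)
    (by simp at hj; omega)
  rw [mul_smul_comm, map_smul, smul_eq_mul, ← this]
  congr 1
  change c j * derivative^[j] p * _ = _
  ring

/-- Integration by parts in `w L q = (x w q')'`; the right side is symmetric, so `L` is symmetric
for the functional. -/
lemma moment_mul_secondOp {α : ℝ} (hα : ∀ j : ℕ, α ≠ -((j : ℝ) + 1)) (p q : ℝ[X]) :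
    moment α (p * secondOp polyD X (α + 1) 0 q) =
      -moment α (X * (derivative p * derivative q)) := by
  have := moment_derivative_mul hα p (derivative q) 0
  simp only [zero_add, pow_one, pow_zero, one_mul, Nat.cast_one] at this
  rw [show X * (derivative p * derivative q) = derivative p * (X * derivative q) by ring, this,
    neg_neg]
  congr 2
  rw [secondOp_apply, eulerOp_apply]; simp

lemma moment_secondOp_comm {α : ℝ} (hα : ∀ j : ℕ, α ≠ -((j : ℝ) + 1)) (p q : ℝ[X]) :
    moment α (p * secondOp polyD X (α + 1) 0 q) =
      moment α (secondOp polyD X (α + 1) 0 p * q) := by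
  rw [moment_mul_secondOp hα, mul_comm _ q, moment_mul_secondOp hα, mul_comm (derivative p)]

lemma moment_laguerre_mul {α : ℝ} (hα : ∀ j : ℕ, α ≠ -((j : ℝ) + 1)) {n m : ℕ} (hnm : n ≠ m) :
    moment α (laguerre α n * laguerre α m) = 0 := by
  have h := moment_secondOp_comm hα (laguerre α n) (laguerre α m)
  rw [laguerre_ode, laguerre_ode, mul_smul_comm, smul_mul_assoc, map_smul, map_smul, smul_eq_mul,
    smul_eq_mul] at h
  have h2 : ((n : ℝ) - m) * moment α (laguerre α n * laguerre α m) = 0 := by linarith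
  rcases mul_eq_zero.mp h2 with h | h
  · exact absurd (Nat.cast_injective (R := ℝ) (by linarith)) hnm
  · exact h

/-- The Dirichlet form of `L` with `(L_{n+1}^α)' = -L_n^{α+1}` expresses `n + 1` times the norm at
`α` by the norm of index `n` at `α + 1`. -/
lemma moment_laguerre_sq {α : ℝ} (hα : ∀ j : ℕ, α ≠ -((j : ℝ) + 1)) (n : ℕ) :
    moment α (laguerre α n * laguerre α n) = Real.Gamma (α + 1 + n) / n.factorial := by
  induction n generalizing α with
  | zero =>
    rw [laguerre_zero, mul_one, ← monomial_zero_one, moment_monomial]; simp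
  | succ n ih =>
    have h := moment_mul_secondOp hα (laguerre α (n + 1)) (laguerre α (n + 1))
    rw [derivative_laguerre_succ, neg_mul_neg, ← moment_add_one,
      ih (fun j h => hα (j + 1) (by push_cast; linarith)), laguerre_ode, mul_smul_comm, map_smul,
      smul_eq_mul] at h
    rw [show α + 1 + 1 + (n : ℝ) = α + 1 + (n + 1 : ℕ) by push_cast; ring] at h
    rw [Nat.factorial_succ]
    have := Nat.cast_ne_zero (R := ℝ).mpr (Nat.factorial_ne_zero n)
    have h3 : ((n + 1 : ℕ) : ℝ) ≠ 0 := by positivity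
    push_cast at h h3 ⊢
    field_simp at h ⊢
    linarith

/-- The Laguerre polynomials as a sequence of polynomials of degree `0, 1, 2, …`. -/
def laguerreSeq (α : ℝ) : Polynomial.Sequence ℝ where
  elems' := laguerre α
  degree_eq' := degree_laguerre α

/-- The Laguerre polynomials as a basis. -/
def laguerreBasis (α : ℝ) : Module.Basis ℕ ℝ ℝ[X] :=
  (laguerreSeq α).basis fun i => ((leadingCoeff_ne_zero.mpr ((laguerreSeq α).ne_zero i)).isUnit)

lemma laguerreBasis_apply (α : ℝ) (n : ℕ) : laguerreBasis α n = laguerre α n :=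
  (laguerreSeq α).basis_eq_self _ n

/-! ### Passage from polynomials to formal power series -/

section Map

variable {R S : Type*} [CommRing R] [Algebra ℝ R] [CommRing S] [Algebra ℝ S]
  {D : Derivation ℝ R R} {D' : Derivation ℝ S S} {x : R} (φ : R →ₐ[ℝ] S)

lemma map_iterate_derivation (hD : ∀ r, φ (D r) = D' (φ r)) (j : ℕ) (p : R) :
    φ (D^[j] p) = D'^[j] (φ p) := by
  induction j with
  | zero => rfl
  | succ j ih => rw [Function.iterate_succ_apply', Function.iterate_succ_apply', hD, ih]

lemma map_diffOp (hD : ∀ r, φ (D r) = D' (φ r)) (k : ℕ) (c : ℕ → R) (p : R) :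
    φ (diffOp D k c p) = diffOp D' k (fun j => φ (c j)) (φ p) := by
  simp only [diffOp_apply, map_sum, map_mul, map_iterate_derivation φ hD]

lemma map_eulerOp (hD : ∀ r, φ (D r) = D' (φ r)) (β : ℝ) (p : R) :
    φ (eulerOp D x β p) = eulerOp D' (φ x) β (φ p) := by
  simp only [eulerOp_apply, map_sub, map_add, map_mul, map_smul, hD]

lemma map_adjPow (hD : ∀ r, φ (D r) = D' (φ r)) (α : ℝ) (j k : ℕ) (p : R) :
    φ (adjPow D x α j k p) = adjPow D' (φ x) α j k (φ p) := by
  induction j generalizing k p with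
  | zero => simp [adjPow]
  | succ j ih => simp only [adjPow, LinearMap.comp_apply, ih, map_eulerOp φ hD]

lemma map_adjOp (hD : ∀ r, φ (D r) = D' (φ r)) (α : ℝ) (k : ℕ) (c : ℕ → R) (p : R) :
    φ (adjOp D x α k c p) = adjOp D' (φ x) α k (fun j => φ (c j)) (φ p) := by
  simp only [adjOp_apply, map_sum, map_smul, map_adjPow φ hD, map_mul]

lemma map_secondOp (hD : ∀ r, φ (D r) = D' (φ r)) (β : ℝ) (V p : R) :
    φ (secondOp D x β V p) = secondOp D' (φ x) β (φ V) (φ p) := by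
  simp only [secondOp_apply, map_sub, map_add, map_mul, map_smul, hD]

lemma map_prodOp (hD : ∀ r, φ (D r) = D' (φ r)) (α : ℝ) (lam : ℕ → ℝ) (k : ℕ) (p : R) :
    φ (prodOp D x α lam k p) = prodOp D' (φ x) α lam k (φ p) := by
  induction k generalizing p with
  | zero => rfl
  | succ k ih =>
    simp only [prodOp, LinearMap.comp_apply, ih, LinearMap.sub_apply, LinearMap.smul_apply,
      LinearMap.id_apply, map_sub, map_smul, map_secondOp φ hD, map_zero]

end Map

/-- The inclusion of polynomials into formal power series. -/
def psOf : ℝ[X] →ₐ[ℝ] PowerSeries ℝ := Polynomial.coeToPowerSeries.algHom ℝ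

lemma psOf_apply (p : ℝ[X]) : psOf p = (p : PowerSeries ℝ) := by
  simp [psOf, Polynomial.coeToPowerSeries.algHom_apply]

lemma psOf_injective : Function.Injective psOf := fun p q h => by
  rw [psOf_apply, psOf_apply] at h
  exact Polynomial.coe_injective ℝ h

lemma psOf_X : psOf X = psX := by rw [psOf_apply, Polynomial.coe_X]

lemma psOf_polyD (p : ℝ[X]) : psOf (polyD p) = psD (psOf p) := by
  rw [psOf_apply, psOf_apply, polyD_apply]
  exact (PowerSeries.derivative_coe p).symm

lemma psOf_iterate_derivative (j : ℕ) (p : ℝ[X]) :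
    psOf (derivative^[j] p) = psD^[j] (psOf p) :=
  map_iterate_derivation (D := polyD) psOf psOf_polyD j p

lemma constantCoeff_psOf (p : ℝ[X]) : PowerSeries.constantCoeff (psOf p) = p.coeff 0 := by
  rw [psOf_apply, Polynomial.constantCoeff_coe]

/-! ### The eigenfunctions of a pair -/

/-- The power series of `e^x`. -/
abbrev psExp : PowerSeries ℝ := PowerSeries.exp ℝ

lemma psD_psExp_mul (p : ℝ[X]) :
    psD (psExp * psOf (p.comp (-X))) = psExp * psOf ((p - derivative p).comp (-X)) := by
  rw [Derivation.leibniz, PowerSeries.derivative_exp, ← psOf_polyD, polyD_apply, derivative_comp,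
    smul_eq_mul, smul_eq_mul]
  simp only [derivative_X, sub_comp, map_sub, neg_mul, one_mul, map_neg]
  ring

/-- Each derivative raises the parameter by one, so the rows of `F₂` are rows of derivatives of a
seed, divided by `e^x`. -/
lemma iterate_psD_psExp_mul (α : ℝ) (f j : ℕ) :
    psD^[j] (psExp * psOf ((laguerre α f).comp (-X))) =
      psExp * psOf ((laguerre (α + j) f).comp (-X)) := by
  induction j with
  | zero => simp
  | succ j ih =>
    rw [Function.iterate_succ_apply', ih, psD_psExp_mul, laguerre_sub_derivative]
    push_cast
    rw [add_assoc]

/-- The substitution `y ↦ e^x y(-x)` conjugates `L` to `α + 1 - L`, which yields the second family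
of seeds. -/
lemma secondOp_psExp_mul (α : ℝ) (f : ℕ) :
    secondOp psD psX (α + 1) 0 (psExp * psOf ((laguerre α f).comp (-X))) =
      ((f : ℝ) + α + 1) • (psExp * psOf ((laguerre α f).comp (-X))) := by
  have h := congrArg (fun p => psOf (p.comp (-X))) (laguerre_ode α f)
  simp only [secondOp_apply, polyD_apply, zero_mul, add_zero, sub_comp, add_comp, mul_comp, X_comp,
    smul_comp, map_sub, map_add, map_mul, map_smul, map_neg, psOf_X] at h
  rw [secondOp_apply, psD_psExp_mul, psD_psExp_mul]
  simp only [sub_comp, map_sub, Algebra.smul_def, zero_mul, add_zero, map_neg,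
    map_add, map_one] at h ⊢
  linear_combination (-psExp) * h

/-- A finite family extended by zero. -/
def extendFin {M : Type*} [Zero M] {k : ℕ} (f : Fin k → M) : ℕ → M :=
  fun i => if h : i < k then f ⟨i, h⟩ else 0

lemma extendFin_coe {M : Type*} [Zero M] {k : ℕ} (f : Fin k → M) (i : Fin k) :
    extendFin f i = f i := by simp [extendFin]

section Pair

variable (α : ℝ) (F₁ F₂ : Finset ℕ)

/-- The eigenfunctions `L_f^α(x)`, `f ∈ F₁`, and `e^x L_f^α(-x)`, `f ∈ F₂`. -/
def pairFun : Fin (F₁.card + F₂.card) → PowerSeries ℝ :=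
  Fin.append (fun i : Fin F₁.card => psOf (laguerre α (F₁.orderEmbOfFin rfl i)))
    (fun i : Fin F₂.card => psExp * psOf ((laguerre α (F₂.orderEmbOfFin rfl i)).comp (-X)))

/-- The eigenvalues of `pairFun`. -/
def pairEig : Fin (F₁.card + F₂.card) → ℝ :=
  Fin.append (fun i : Fin F₁.card => -((F₁.orderEmbOfFin rfl i : ℕ) : ℝ))
    (fun i : Fin F₂.card => ((F₂.orderEmbOfFin rfl i : ℕ) : ℝ) + α + 1)

/-- The exponential factors of `pairFun`. -/
def pairExp : Fin (F₁.card + F₂.card) → PowerSeries ℝ :=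
  Fin.append (fun _ : Fin F₁.card => 1) (fun _ : Fin F₂.card => psExp)

lemma prod_pairExp : ∏ i, pairExp F₁ F₂ i = psExp ^ F₂.card := by
  rw [Fin.prod_univ_add]
  simp [pairExp]

lemma iterate_psD_pairFun (m : ℕ) (i : Fin (F₁.card + F₂.card)) (j : Fin m) :
    psD^[j] (pairFun α F₁ F₂ i) = pairExp F₁ F₂ i * psOf (pairRows α F₁ F₂ m i j) := by
  refine Fin.addCases (fun i => ?_) (fun i => ?_) i
  · simp only [pairFun, pairExp, pairRows, Fin.append_left, one_mul, derivRow,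
      psOf_iterate_derivative]
  · simp only [pairFun, pairExp, pairRows, Fin.append_right, shiftRow, iterate_psD_psExp_mul]

lemma secondOp_pairFun (i : Fin (F₁.card + F₂.card)) :
    secondOp psD psX (α + 1) 0 (pairFun α F₁ F₂ i) = pairEig α F₁ F₂ i • pairFun α F₁ F₂ i := by
  refine Fin.addCases (fun i => ?_) (fun i => ?_) i
  · simp only [pairFun, pairEig, Fin.append_left]
    rw [← psOf_X, ← map_zero psOf, ← map_secondOp psOf psOf_polyD, laguerre_ode, map_smul]
  · simp only [pairFun, pairEig, Fin.append_right, secondOp_psExp_mul]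

lemma prod_pairEig_add (n : ℕ) : ∏ i, (pairEig α F₁ F₂ i + n) =
    (∏ f ∈ F₁, ((n : ℝ) - f)) * ∏ f ∈ F₂, ((n : ℝ) + (α + 1) + f) := by
  have h : ∀ (F : Finset ℕ) (g : ℕ → ℝ), ∏ i : Fin F.card, g (F.orderEmbOfFin rfl i) =
      ∏ f ∈ F, g f := by
    intro F g
    conv_rhs => rw [← Finset.map_orderEmbOfFin_univ F rfl, Finset.prod_map]
    rfl
  rw [Fin.prod_univ_add]
  simp only [pairEig, Fin.append_left, Fin.append_right]
  rw [← h F₁, ← h F₂]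
  congr 1
  · exact Finset.prod_congr rfl fun i _ => by ring
  · exact Finset.prod_congr rfl fun i _ => by ring

variable {α}

lemma constantCoeff_pairFun_ne_zero (hα : ∀ j : ℕ, α ≠ -((j : ℝ) + 1))
    (i : Fin (F₁.card + F₂.card)) : PowerSeries.constantCoeff (pairFun α F₁ F₂ i) ≠ 0 := by
  refine Fin.addCases (fun i => ?_) (fun i => ?_) i
  · simp only [pairFun, Fin.append_left, constantCoeff_psOf]
    exact coeff_laguerre_zero_ne hα _
  · simp only [pairFun, Fin.append_right, map_mul, constantCoeff_psOf]
    rw [PowerSeries.constantCoeff_exp, one_mul, coeff_zero_eq_eval_zero, eval_comp]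
    simpa [coeff_zero_eq_eval_zero] using coeff_laguerre_zero_ne hα _

/-- A coincidence `-a = b + α + 1` between the two families would make `α` a negative integer. -/
lemma pairEig_injective (hα : ∀ j : ℕ, α ≠ -((j : ℝ) + 1)) :
    Function.Injective (pairEig α F₁ F₂) := by
  have key : ∀ a b : ℕ, -(a : ℝ) ≠ (b : ℝ) + α + 1 := fun a b h =>
    hα (a + b) (by push_cast; linarith)
  intro i j
  refine Fin.addCases (fun i => ?_) (fun i => ?_) i <;>
    refine Fin.addCases (fun j => ?_) (fun j => ?_) j
  · simp only [pairEig, Fin.append_left, neg_inj, Nat.cast_inj]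
    intro h
    rw [(F₁.orderEmbOfFin rfl).injective h]
  · simp only [pairEig, Fin.append_left, Fin.append_right]
    exact fun h => absurd h (key _ _)
  · simp only [pairEig, Fin.append_left, Fin.append_right]
    exact fun h => absurd h.symm (key _ _)
  · simp only [pairEig, Fin.append_right, add_left_inj, Nat.cast_inj]
    intro h
    rw [(F₂.orderEmbOfFin rfl).injective h]

variable (α)

/-- The cofactors of the first row in the determinants `L_n^{α;F}`. -/
def pairCoeff (j : ℕ) : ℝ[X] :=
  Matrix.det (Matrix.of
    (Fin.cons (fun i => if (i : ℕ) = j then 1 else 0)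
      (pairRows α F₁ F₂ (F₁.card + F₂.card + 1)) :
      Fin (F₁.card + F₂.card + 1) → Fin (F₁.card + F₂.card + 1) → ℝ[X]))

/-- The differential operator `p ↦ det (p-row; rows of the pair)`. -/
def pairOp : ℝ[X] →ₗ[ℝ] ℝ[X] := diffOp polyD (F₁.card + F₂.card) (pairCoeff α F₁ F₂)

lemma excLaguerre_eq_pairOp (n : ℕ) :
    excLaguerre α F₁ F₂ n = pairOp α F₁ F₂ (laguerre α (n - uIndex F₁ F₂)) := by
  rw [excLaguerre, pairOp, diffOp_apply, Finset.sum_range, Matrix.det_succ_row_zero]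
  refine Finset.sum_congr rfl fun j _ => ?_
  rw [pairCoeff, Matrix.det_succ_row_zero, Finset.sum_eq_single j]
  · simp only [Matrix.of_apply, Fin.cons_zero, derivRow, if_true, mul_one]
    change _ = _ * derivative^[j] _
    rw [mul_right_comm]
    rfl
  · intro i _ hij
    simp only [Matrix.of_apply, Fin.cons_zero]
    rw [if_neg (fun h => hij (Fin.ext h))]; simp
  · simp

lemma det_wronskiMatrix_pairFun :
    (wronskiMatrix (extendFin (pairFun α F₁ F₂)) (F₁.card + F₂.card)).det =
      psExp ^ F₂.card * psOf (Omega α F₁ F₂) := by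
  rw [← prod_pairExp, Omega, AlgHom.map_det, ← Matrix.det_mul_column]
  congr 1
  ext1 i j
  simp only [wronskiMatrix, Matrix.of_apply, extendFin_coe, iterate_psD_pairFun,
    AlgHom.mapMatrix_apply, Matrix.map_apply]

variable {F₁ F₂}

/-- Both sides are the cofactor of the first row in the determinant of seeds, once the common factor
`e^{k₂ x}` is cancelled. Thus `pairOp` is `(-1)^k Ω T`. -/
lemma DarbouxChain.psOf_pairCoeff {c : ℕ → PowerSeries ℝ} {V : PowerSeries ℝ}
    (H : DarbouxChain α (extendFin (pairFun α F₁ F₂)) (extendFin (pairEig α F₁ F₂))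
      (F₁.card + F₂.card) c V) {j : ℕ} (hj : j ≤ F₁.card + F₂.card) :
    psOf (pairCoeff α F₁ F₂ j) =
      (-1) ^ (F₁.card + F₂.card) * c j * psOf (Omega α F₁ F₂) := by
  set k := F₁.card + F₂.card with hk
  have h := H.det_cons (fun i => if (i : ℕ) = j then 1 else 0)
  rw [det_wronskiMatrix_pairFun, Finset.sum_eq_single ⟨j, by omega⟩
    (fun i _ hi => by rw [if_neg (fun h => hi (Fin.ext h)), mul_zero]) (by simp)] at h
  simp only [if_true, mul_one] at h
  have h2 : (Matrix.of (Fin.cons (fun i => if (i : ℕ) = j then 1 else 0)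
      fun (i : Fin k) (l : Fin (k + 1)) => psD^[l] (extendFin (pairFun α F₁ F₂) i) :
      Fin (k + 1) → Fin (k + 1) → PowerSeries ℝ)).det =
      psExp ^ F₂.card * psOf (pairCoeff α F₁ F₂ j) := by
    have h3 : psExp ^ F₂.card = ∏ i, (Fin.cons 1 (pairExp F₁ F₂) : Fin (k + 1) → PowerSeries ℝ) i := by
      rw [Fin.prod_univ_succ]
      simp only [Fin.cons_zero, Fin.cons_succ, one_mul]
      exact (prod_pairExp F₁ F₂).symm
    rw [h3, pairCoeff, AlgHom.map_det, ← Matrix.det_mul_column]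
    congr 1
    ext1 i l
    refine Fin.cases ?_ (fun i => ?_) i
    · simp only [Matrix.of_apply, Fin.cons_zero, one_mul, AlgHom.mapMatrix_apply, Matrix.map_apply]
      split_ifs <;> simp
    · simp only [Matrix.of_apply, Fin.cons_succ, AlgHom.mapMatrix_apply, Matrix.map_apply]
      rw [extendFin_coe, iterate_psD_pairFun]
  rw [h2] at h
  have hE : psExp ^ F₂.card ≠ 0 := pow_ne_zero _ (PowerSeries.isUnit_exp ℝ).ne_zero
  refine mul_left_cancel₀ hE ?_
  rw [h]; ring

end Pair

/-! ### The transformation of the pair, its adjoint and their product -/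

section Pair

variable {α : ℝ} {F₁ F₂ : Finset ℕ}

/-- The eigenvalue of `∏ (λ_i - L)` at `L_n^α`. -/
def pairNorm (α : ℝ) (F₁ F₂ : Finset ℕ) (n : ℕ) : ℝ :=
  (∏ f ∈ F₁, ((n : ℝ) - f)) * ∏ f ∈ F₂, ((n : ℝ) + (α + 1) + f)

/-- The operator `∏ (λ_i - L)` of the pair. -/
def pairProd (α : ℝ) (F₁ F₂ : Finset ℕ) : ℝ[X] →ₗ[ℝ] ℝ[X] :=
  prodOp polyD X α (extendFin (pairEig α F₁ F₂)) (F₁.card + F₂.card)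

/-- The adjoint of `pairOp`. -/
def pairAdj (α : ℝ) (F₁ F₂ : Finset ℕ) : ℝ[X] →ₗ[ℝ] ℝ[X] :=
  adjOp polyD X α (F₁.card + F₂.card) (pairCoeff α F₁ F₂)

lemma prodOp_laguerre (α : ℝ) (lam : ℕ → ℝ) (k n : ℕ) :
    prodOp polyD X α lam k (laguerre α n) =
      (∏ i ∈ Finset.range k, (lam i + n)) • laguerre α n := by
  induction k with
  | zero => simp [prodOp]
  | succ k ih =>
    simp only [prodOp, LinearMap.comp_apply, LinearMap.sub_apply, LinearMap.smul_apply,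
      LinearMap.id_apply, laguerre_ode, ← sub_smul, map_smul, ih, smul_smul,
      Finset.prod_range_succ]
    congr 1; ring

lemma pairProd_laguerre (α : ℝ) (F₁ F₂ : Finset ℕ) (n : ℕ) :
    pairProd α F₁ F₂ (laguerre α n) = pairNorm α F₁ F₂ n • laguerre α n := by
  rw [pairProd, prodOp_laguerre, pairNorm, ← prod_pairEig_add, Finset.prod_range]
  simp only [extendFin_coe]

/-- The properties of the pair that follow from the Darboux chain. -/
lemma exists_pair_chain (hα : ∀ j : ℕ, α ≠ -((j : ℝ) + 1)) (F₁ F₂ : Finset ℕ) :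
    ∃ c V, DarbouxChain α (extendFin (pairFun α F₁ F₂)) (extendFin (pairEig α F₁ F₂))
      (F₁.card + F₂.card) c V ∧ (Omega α F₁ F₂).coeff 0 ≠ 0 ∧
      (0 < F₁.card + F₂.card → psOf (derivative (Omega α F₁ F₂) +
        (F₂.card : ℝ[X]) * Omega α F₁ F₂) =
          -c (F₁.card + F₂.card - 1) * psOf (Omega α F₁ F₂)) := by
  set k := F₁.card + F₂.card with hk
  obtain ⟨c, V, H, hW, hD⟩ := exists_darbouxChain hα (extendFin (pairFun α F₁ F₂))
    (extendFin (pairEig α F₁ F₂)) k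
    (fun i hi => by
      have := secondOp_pairFun α F₁ F₂ (⟨i, hi⟩ : Fin k)
      rwa [← extendFin_coe (pairFun α F₁ F₂), ← extendFin_coe (pairEig α F₁ F₂)] at this)
    (fun i hi => by
      have := extendFin_coe (pairFun α F₁ F₂) (⟨i, hi⟩ : Fin k)
      rw [show extendFin (pairFun α F₁ F₂) i = _ from this]
      exact constantCoeff_pairFun_ne_zero F₁ F₂ hα _)
    (fun i hi j hj => by
      have h1 := extendFin_coe (pairEig α F₁ F₂) (⟨i, hi⟩ : Fin k)
      have h2 := extendFin_coe (pairEig α F₁ F₂) (⟨j, by omega⟩ : Fin k)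
      rw [show extendFin (pairEig α F₁ F₂) i = _ from h1,
        show extendFin (pairEig α F₁ F₂) j = _ from h2]
      intro h
      have := congrArg Fin.val (pairEig_injective F₁ F₂ hα h)
      simp only at this
      omega)
  refine ⟨c, V, H, ?_, ?_⟩
  · rw [det_wronskiMatrix_pairFun, map_mul, constantCoeff_psOf] at hW
    exact right_ne_zero_of_mul hW
  · intro hk0
    rw [det_wronskiMatrix_pairFun, if_neg (by omega), Derivation.leibniz, Derivation.leibniz_pow,
      PowerSeries.derivative_exp, ← psOf_polyD, polyD_apply] at hD
    have hE : psExp ^ F₂.card ≠ 0 := pow_ne_zero _ (PowerSeries.isUnit_exp ℝ).ne_zero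
    refine mul_left_cancel₀ hE ?_
    rw [map_add, map_mul, map_natCast]
    have h3 : F₂.card • psExp ^ (F₂.card - 1) • psExp = (F₂.card : PowerSeries ℝ) * psExp ^ F₂.card := by
      rcases F₂.card with _ | n
      · simp
      · rw [nsmul_eq_mul, smul_eq_mul, Nat.add_sub_cancel, pow_succ]
    rw [h3, smul_eq_mul, smul_eq_mul] at hD
    linear_combination hD

lemma DarbouxChain.psOf_pairOp {c : ℕ → PowerSeries ℝ} {V : PowerSeries ℝ}
    (H : DarbouxChain α (extendFin (pairFun α F₁ F₂)) (extendFin (pairEig α F₁ F₂))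
      (F₁.card + F₂.card) c V) (p : ℝ[X]) :
    psOf (pairOp α F₁ F₂ p) = (-1) ^ (F₁.card + F₂.card) * psOf (Omega α F₁ F₂) *
      diffOp psD (F₁.card + F₂.card) c (psOf p) := by
  rw [pairOp, map_diffOp psOf psOf_polyD, diffOp_apply, diffOp_apply, Finset.mul_sum]
  refine Finset.sum_congr rfl fun j hj => ?_
  rw [H.psOf_pairCoeff α (by simp at hj; omega)]
  ring

lemma DarbouxChain.psOf_pairAdj {c : ℕ → PowerSeries ℝ} {V : PowerSeries ℝ}
    (H : DarbouxChain α (extendFin (pairFun α F₁ F₂)) (extendFin (pairEig α F₁ F₂))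
      (F₁.card + F₂.card) c V) (s : ℝ[X]) :
    psOf (pairAdj α F₁ F₂ s) = adjOp psD psX α (F₁.card + F₂.card) c
      ((-1) ^ (F₁.card + F₂.card) * psOf (Omega α F₁ F₂) * psOf s) := by
  rw [pairAdj, map_adjOp psOf psOf_polyD, psOf_X, adjOp_apply, adjOp_apply]
  refine Finset.sum_congr rfl fun j hj => ?_
  rw [H.psOf_pairCoeff α (by simp at hj; omega)]
  congr 2
  ring

lemma coeff_zero_Omega_ne_zero (hα : ∀ j : ℕ, α ≠ -((j : ℝ) + 1)) :
    (Omega α F₁ F₂).coeff 0 ≠ 0 := by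
  obtain ⟨c, V, _, h, _⟩ := exists_pair_chain hα F₁ F₂
  exact h

/-- The subleading coefficient of `T` is minus the logarithmic derivative of the Wronskian `e^{k₂ x}
Ω`. This coefficient brings `Ω'` into the exclusion of zeros. -/
lemma pairCoeff_pred (hα : ∀ j : ℕ, α ≠ -((j : ℝ) + 1)) (hk : 0 < F₁.card + F₂.card) :
    pairCoeff α F₁ F₂ (F₁.card + F₂.card - 1) = (-1) ^ (F₁.card + F₂.card + 1) *
      (derivative (Omega α F₁ F₂) + (F₂.card : ℝ[X]) * Omega α F₁ F₂) := by
  obtain ⟨c, V, H, _, h⟩ := exists_pair_chain hα F₁ F₂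
  apply psOf_injective
  rw [H.psOf_pairCoeff α (by omega), map_mul, h hk, map_pow, map_neg, map_one, pow_succ]
  ring

/-- The hypothesis says that `T*` kills `T r - (±Ω s)`, and `T*` is injective on power series. -/
lemma pairOp_eq_of_pairProd_eq (hα : ∀ j : ℕ, α ≠ -((j : ℝ) + 1)) {r s : ℝ[X]}
    (h : pairProd α F₁ F₂ r = pairAdj α F₁ F₂ s) :
    pairOp α F₁ F₂ r = Omega α F₁ F₂ ^ 2 * s := by
  obtain ⟨c, V, H, _, _⟩ := exists_pair_chain hα F₁ F₂
  have h1 := congrArg psOf h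
  rw [H.psOf_pairAdj, pairProd, map_prodOp psOf psOf_polyD, psOf_X, ← H.factor] at h1
  have h2 := H.adj_injective _ (by rw [map_sub, h1, sub_self] :
    adjOp psD psX α (F₁.card + F₂.card) c (diffOp psD (F₁.card + F₂.card) c (psOf r) -
      (-1) ^ (F₁.card + F₂.card) * psOf (Omega α F₁ F₂) * psOf s) = 0)
  apply psOf_injective
  rw [H.psOf_pairOp, sub_eq_zero.mp h2, map_mul, map_pow]
  have : ((-1) ^ (F₁.card + F₂.card) : PowerSeries ℝ) * (-1) ^ (F₁.card + F₂.card) = 1 := by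
    rw [← mul_pow]; simp
  linear_combination (psOf (Omega α F₁ F₂) ^ 2 * psOf s) * this

lemma pairProd_eq_zero_of_pairOp_eq_zero (hα : ∀ j : ℕ, α ≠ -((j : ℝ) + 1)) {r : ℝ[X]}
    (h : pairOp α F₁ F₂ r = 0) : pairProd α F₁ F₂ r = 0 := by
  obtain ⟨c, V, H, hΩ, _⟩ := exists_pair_chain hα F₁ F₂
  have h1 := H.psOf_pairOp r
  rw [h, map_zero] at h1
  have hΩ' : psOf (Omega α F₁ F₂) ≠ 0 := fun h => hΩ (by
    rw [← constantCoeff_psOf, h, map_zero])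
  have h2 : diffOp psD (F₁.card + F₂.card) c (psOf r) = 0 := by
    rcases mul_eq_zero.mp h1.symm with h | h
    · rcases mul_eq_zero.mp h with h | h
      · exact absurd h (pow_ne_zero _ (by simp))
      · exact absurd h hΩ'
    · exact h
  apply psOf_injective
  rw [pairProd, map_prodOp psOf psOf_polyD, psOf_X, ← H.factor, h2]
  simp

lemma pairOp_laguerre_of_mem (hα : ∀ j : ℕ, α ≠ -((j : ℝ) + 1)) {f : ℕ} (hf : f ∈ F₁) :
    pairOp α F₁ F₂ (laguerre α f) = 0 := by
  obtain ⟨c, V, H, _, _⟩ := exists_pair_chain hα F₁ F₂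
  obtain ⟨i, hi⟩ : f ∈ Set.range (F₁.orderEmbOfFin rfl) := by
    rw [Finset.range_orderEmbOfFin]; exact hf
  have h1 : extendFin (pairFun α F₁ F₂) (Fin.castAdd F₂.card i : Fin _) = psOf (laguerre α f) := by
    rw [extendFin_coe, pairFun, Fin.append_left, hi]
  apply psOf_injective
  rw [H.psOf_pairOp, ← h1, H.annihilate _ (Fin.is_lt _), mul_zero, map_zero]

/-- The Sturm-Liouville identity between transformed Laguerre polynomials. -/
lemma pairOp_laguerre_identity (hα : ∀ j : ℕ, α ≠ -((j : ℝ) + 1)) (n m : ℕ) :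
    ∀ P Q N Ω, P = pairOp α F₁ F₂ (laguerre α n) → Q = pairOp α F₁ F₂ (laguerre α m) →
    N = derivative P * Q - P * derivative Q → Ω = Omega α F₁ F₂ →
    X * (derivative N * Ω - 2 * N * derivative Ω) +
      (C (α + 1 + (F₁.card + F₂.card : ℕ)) - X) * (N * Ω) = C ((m : ℝ) - n) * (P * Q * Ω) := by
  intro P Q N Ω hP hQ hN hΩ
  obtain ⟨c, V, H, _, _⟩ := exists_pair_chain hα F₁ F₂
  set k := F₁.card + F₂.card with hk
  have hPs := H.psOf_pairOp (laguerre α n)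
  have hQs := H.psOf_pairOp (laguerre α m)
  have hLy := H.intertwine (psOf (laguerre α n))
  have hLz := H.intertwine (psOf (laguerre α m))
  have hode : ∀ i, secondOp psD psX (α + 1) 0 (psOf (laguerre α i)) =
      (-(i : ℝ)) • psOf (laguerre α i) := by
    intro i
    rw [← psOf_X, ← map_zero psOf, ← map_secondOp psOf psOf_polyD, laguerre_ode, map_smul]
  rw [hode, map_smul] at hLy hLz
  rw [← hP, ← hΩ, ← hk] at hPs
  rw [← hQ, ← hΩ, ← hk] at hQs
  set y := diffOp psD k c (psOf (laguerre α n))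
  set z := diffOp psD k c (psOf (laguerre α m))
  set ω := psOf Ω
  set ε : PowerSeries ℝ := (-1) ^ k with hε
  have hε2 : ε * ε = 1 := by rw [hε, ← mul_pow]; simp
  have hDε : psD ε = 0 := by
    rw [hε]
    have : ((-1 : PowerSeries ℝ)) ^ k = algebraMap ℝ _ ((-1) ^ k) := by simp
    rw [this, Derivation.map_algebraMap]
  have hNs : psOf N = ω * ω * (psD y * z - y * psD z) := by
    rw [hN, map_sub, map_mul, map_mul, ← polyD_apply, ← polyD_apply, psOf_polyD, psOf_polyD, hPs,
      hQs]
    simp only [Derivation.leibniz, smul_eq_mul, hDε]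
    linear_combination (ω * ω * (psD y * z - y * psD z)) * hε2
  have hCs : ∀ r : ℝ, psOf (C r) = algebraMap ℝ _ r := fun r => psOf.commutes r
  apply psOf_injective
  simp only [map_add, map_sub, map_mul, map_ofNat]
  rw [← polyD_apply, ← polyD_apply, psOf_polyD, psOf_polyD, hPs, hQs, hNs, psOf_X]
  simp only [← map_add, ← map_sub, hCs]
  rw [secondOp_apply] at hLy hLz
  simp only [Derivation.leibniz, map_sub, smul_eq_mul, map_add, Algebra.smul_def, map_neg]
    at hLy hLz ⊢
  change _ = (algebraMap ℝ (PowerSeries ℝ) (m : ℝ) - algebraMap ℝ (PowerSeries ℝ) (n : ℝ)) *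
    ((ε * ω * y) * (ε * ω * z) * ω)
  linear_combination (ω ^ 3 * z) * hLy - (ω ^ 3 * y) * hLz -
    ((algebraMap ℝ (PowerSeries ℝ) (m : ℝ) - algebraMap ℝ (PowerSeries ℝ) (n : ℝ)) *
      ω ^ 3 * y * z) * hε2

/-! ### The positive semidefinite form -/

lemma pairNorm_eq_zero_iff (hα : ∀ j : ℕ, α ≠ -((j : ℝ) + 1)) (n : ℕ) :
    pairNorm α F₁ F₂ n = 0 ↔ n ∈ F₁ := by
  rw [pairNorm, mul_eq_zero, Finset.prod_eq_zero_iff, Finset.prod_eq_zero_iff]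
  constructor
  · rintro (⟨f, hf, h⟩ | ⟨f, hf, h⟩)
    · rw [Nat.cast_injective (R := ℝ) (sub_eq_zero.mp h)]; exact hf
    · exact absurd (by push_cast; linarith) (hα (n + f))
  · intro h
    exact Or.inl ⟨n, h, sub_self _⟩

lemma Gamma_add_nat {y : ℝ} (hy : ∀ i : ℕ, y + i ≠ 0) (j : ℕ) :
    Real.Gamma (y + j) = (ascPochhammer ℝ j).eval y * Real.Gamma y := by
  induction j with
  | zero => simp
  | succ j ih =>
    rw [ascPochhammer_succ_eval]
    push_cast
    rw [← add_assoc, Real.Gamma_add_one (hy j), ih]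
    ring

lemma add_toNat_neg_floor_pos {c : ℝ} (hc : ∀ j : ℕ, c ≠ -(j : ℝ)) :
    0 < c + (-⌊c⌋).toNat := by
  have h1 : 0 ≤ c + (-⌊c⌋).toNat := by
    have h2 : ((-⌊c⌋ : ℤ) : ℝ) ≤ ((-⌊c⌋).toNat : ℝ) := by
      exact_mod_cast Int.self_le_toNat (-⌊c⌋)
    push_cast at h2
    linarith [Int.floor_le c]
  rcases h1.lt_or_eq with h | h
  · exact h
  · exact absurd (by linarith) (hc (-⌊c⌋).toNat)

/-- `Γ(α + 1 + n)` is a positive Gamma value divided by the rising factorial in the admissibility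
condition, so the sign is that of the admissible quotient. -/
lemma pairNorm_mul_nonneg (hα : ∀ j : ℕ, α ≠ -((j : ℝ) + 1)) (hadm : Admissible (α + 1) F₁ F₂)
    (n : ℕ) : 0 ≤ pairNorm α F₁ F₂ n * moment α (laguerre α n * laguerre α n) := by
  rw [moment_laguerre_sq hα]
  have hne : ∀ i : ℕ, (n : ℝ) + (α + 1) + i ≠ 0 := fun i h =>
    hα (n + i) (by push_cast; linarith)
  have h1 := Gamma_add_nat hne (-⌊α + 1⌋).toNat
  have h2 : 0 < Real.Gamma ((n : ℝ) + (α + 1) + (-⌊α + 1⌋).toNat) := by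
    apply Real.Gamma_pos_of_pos
    have := add_toNat_neg_floor_pos (c := α + 1) fun j h => hα j (by linarith)
    have : (0 : ℝ) ≤ n := Nat.cast_nonneg n
    linarith
  have h3 := hadm n
  set A := (ascPochhammer ℝ (-⌊α + 1⌋).toNat).eval ((n : ℝ) + (α + 1))
  have hA : A ≠ 0 := fun h => by rw [h1, h, zero_mul] at h2; exact lt_irrefl _ h2
  have h4 : Real.Gamma (α + 1 + n) =
      Real.Gamma ((n : ℝ) + (α + 1) + (-⌊α + 1⌋).toNat) / A := by
    rw [h1, add_comm (α + 1), mul_div_cancel_left₀ _ hA]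
  rw [h4]
  have h5 : pairNorm α F₁ F₂ n *
      (Real.Gamma ((n : ℝ) + (α + 1) + (-⌊α + 1⌋).toNat) / A / n.factorial) =
      (pairNorm α F₁ F₂ n / A) *
        (Real.Gamma ((n : ℝ) + (α + 1) + (-⌊α + 1⌋).toNat) / n.factorial) := by
    ring
  rw [h5]
  exact mul_nonneg h3 (by positivity)

lemma moment_mul_pairProd (hα : ∀ j : ℕ, α ≠ -((j : ℝ) + 1)) (s : Finset ℕ) (a b : ℕ → ℝ) :
    moment α ((∑ n ∈ s, a n • laguerre α n) * pairProd α F₁ F₂ (∑ n ∈ s, b n • laguerre α n)) =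
      ∑ n ∈ s, a n * b n * (pairNorm α F₁ F₂ n * moment α (laguerre α n * laguerre α n)) := by
  rw [map_sum, Finset.sum_mul, map_sum]
  refine Finset.sum_congr rfl fun n hn => ?_
  rw [Finset.mul_sum, map_sum, Finset.sum_eq_single n]
  · rw [map_smul, pairProd_laguerre, smul_mul_smul_comm, mul_smul_comm, map_smul, map_smul]
    simp only [smul_eq_mul]
  · intro m _ hmn
    rw [map_smul, pairProd_laguerre, smul_mul_smul_comm, mul_smul_comm, map_smul, map_smul,
      moment_laguerre_mul hα (Ne.symm hmn)]
    simp
  · exact fun h => absurd hn h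

lemma eq_sum_laguerre (α : ℝ) (p : ℝ[X]) {s : Finset ℕ}
    (hs : ((laguerreBasis α).repr p).support ⊆ s) :
    p = ∑ n ∈ s, ((laguerreBasis α).repr p n) • laguerre α n := by
  conv_lhs => rw [← (laguerreBasis α).linearCombination_repr p, Finsupp.linearCombination_apply,
    Finsupp.sum_of_support_subset _ hs _ (by simp)]
  simp only [laguerreBasis_apply]

/-- The Cauchy-Schwarz inequality for the form `Λ(p ∏ (λ_i - L) q)`. -/
lemma moment_mul_pairProd_sq_le (hα : ∀ j : ℕ, α ≠ -((j : ℝ) + 1))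
    (hadm : Admissible (α + 1) F₁ F₂) (p q : ℝ[X]) :
    moment α (p * pairProd α F₁ F₂ q) ^ 2 ≤
      moment α (p * pairProd α F₁ F₂ p) * moment α (q * pairProd α F₁ F₂ q) := by
  set s := ((laguerreBasis α).repr p).support ∪ ((laguerreBasis α).repr q).support
  have hp := eq_sum_laguerre α p (s := s) Finset.subset_union_left
  have hq := eq_sum_laguerre α q (s := s) Finset.subset_union_right
  set a := (laguerreBasis α).repr p
  set b := (laguerreBasis α).repr q
  rw [hp, hq, moment_mul_pairProd hα, moment_mul_pairProd hα, moment_mul_pairProd hα]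
  have hw := pairNorm_mul_nonneg hα hadm
  refine Finset.sum_sq_le_sum_mul_sum_of_sq_le_mul s (fun n _ => ?_) (fun n _ => ?_) fun n _ => ?_
  · exact mul_nonneg (mul_self_nonneg _) (hw n)
  · exact mul_nonneg (mul_self_nonneg _) (hw n)
  · exact le_of_eq (by ring)

lemma moment_laguerre_mul_eq (hα : ∀ j : ℕ, α ≠ -((j : ℝ) + 1)) (g : ℝ[X]) (n : ℕ) :
    moment α (laguerre α n * g) =
      (laguerreBasis α).repr g n * moment α (laguerre α n * laguerre α n) := by
  have hg := eq_sum_laguerre α g (s := insert n ((laguerreBasis α).repr g).support)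
    (Finset.subset_insert _ _)
  conv_lhs => rw [hg]
  rw [Finset.mul_sum, map_sum, Finset.sum_eq_single n]
  · rw [mul_smul_comm, map_smul, smul_eq_mul]
  · intro m _ hmn
    rw [mul_smul_comm, map_smul, moment_laguerre_mul hα (Ne.symm hmn), smul_zero]
  · simp

lemma moment_pairOp_mul (hα : ∀ j : ℕ, α ≠ -((j : ℝ) + 1)) (p s : ℝ[X]) :
    moment α (pairOp α F₁ F₂ p * (X ^ (F₁.card + F₂.card) * s)) =
      moment α (p * pairAdj α F₁ F₂ s) :=
  moment_diffOp_mul hα _ _ p s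

lemma exists_pairProd_eq_pairAdj (hα : ∀ j : ℕ, α ≠ -((j : ℝ) + 1)) (s : ℝ[X]) :
    ∃ r, pairProd α F₁ F₂ r = pairAdj α F₁ F₂ s := by
  set g := pairAdj α F₁ F₂ s with hg
  refine ⟨∑ n ∈ ((laguerreBasis α).repr g).support,
    ((laguerreBasis α).repr g n / pairNorm α F₁ F₂ n) • laguerre α n, ?_⟩
  rw [map_sum]
  conv_rhs => rw [eq_sum_laguerre α g subset_rfl]
  refine Finset.sum_congr rfl fun n _ => ?_
  rw [map_smul, pairProd_laguerre, smul_smul]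
  congr 1
  -- For `n ∈ F₁` the eigenvalue is zero and the witness has coefficient `0` by division by zero.
  -- Solvability holds since `pairOp` kills `L_n^α`, so by duality `g` has no component along it.
  by_cases hn : n ∈ F₁
  · have h1 := moment_laguerre_mul_eq hα g n
    rw [hg, ← moment_pairOp_mul hα, pairOp_laguerre_of_mem hα hn, zero_mul, map_zero, ← hg,
      moment_laguerre_sq hα] at h1
    have h2 : Real.Gamma (α + 1 + n) ≠ 0 := Real.Gamma_ne_zero fun m h =>
      hα (n + m) (by push_cast; linarith)
    have h3 : (laguerreBasis α).repr g n = 0 := by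
      rcases mul_eq_zero.mp h1.symm with h | h
      · exact h
      · exact absurd h (div_ne_zero h2 (Nat.cast_ne_zero.mpr (Nat.factorial_ne_zero n)))
    rw [h3]; simp
  · exact div_mul_cancel₀ _ (fun h => hn ((pairNorm_eq_zero_iff hα n).mp h))

/-- Every multiple of `Ω²` is in the range of `pairOp`. -/
lemma exists_pairOp_eq (hα : ∀ j : ℕ, α ≠ -((j : ℝ) + 1)) (s : ℝ[X]) :
    ∃ r, pairOp α F₁ F₂ r = Omega α F₁ F₂ ^ 2 * s := by
  obtain ⟨r, hr⟩ := exists_pairProd_eq_pairAdj (F₁ := F₁) (F₂ := F₂) hα s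
  exact ⟨r, pairOp_eq_of_pairProd_eq hα hr⟩

/-- The basic estimate: `s ↦ Λ(x^k (pairOp p) s)` is bounded with respect to the norm
`Λ(x^k Ω² s²)`. -/
lemma moment_pairOp_sq_le (hα : ∀ j : ℕ, α ≠ -((j : ℝ) + 1))
    (hadm : Admissible (α + 1) F₁ F₂) (p s : ℝ[X]) :
    moment α (X ^ (F₁.card + F₂.card) * (pairOp α F₁ F₂ p * s)) ^ 2 ≤
      moment α (p * pairProd α F₁ F₂ p) *
        moment α (X ^ (F₁.card + F₂.card) * (Omega α F₁ F₂ * s) ^ 2) := by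
  obtain ⟨r, hr⟩ := exists_pairProd_eq_pairAdj (F₁ := F₁) (F₂ := F₂) hα s
  have h := moment_mul_pairProd_sq_le hα hadm p r
  rw [hr, ← moment_pairOp_mul hα, ← moment_pairOp_mul hα, pairOp_eq_of_pairProd_eq hα hr] at h
  convert h using 3
  · ring
  · ring_nf

/-- Admissibility forces `α + k > -1`. -/
lemma neg_one_lt_of_admissible (hα : ∀ j : ℕ, α ≠ -((j : ℝ) + 1)) (hF₁ : ∀ f ∈ F₁, 0 < f)
    (hadm : Admissible (α + 1) F₁ F₂) : -1 < α + (F₁.card + F₂.card : ℕ) := by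
  by_contra hcon
  set k := F₁.card + F₂.card with hk
  have hlt : α + 1 + k < 0 := by
    rcases lt_or_eq_of_le (not_lt.mp hcon) with h | h
    · linarith
    · exact absurd (by linarith) (hα k)
  have hγ : ∀ n : ℕ, Real.Gamma (α + 1 + n) ≠ 0 := fun n => Real.Gamma_ne_zero fun m h =>
    hα (n + m) (by push_cast; linarith)
  set γ : ℕ → ℝ := fun n => Real.Gamma (α + 1 + n) with hγdef
  -- Were `α + k ≤ -1`, then `α + 1 + n < 0` for `n ≤ k`, so `Γ(α + 1 + n)` would alternate in sign
  -- up to `n = k + 1`.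
  have hsign : ∀ n, n ≤ k + 1 → 0 < (-1) ^ n * γ n * γ 0 := by
    intro n
    induction n with
    | zero =>
      intro _
      rw [pow_zero, one_mul]
      exact mul_self_pos.mpr (hγ 0)
    | succ n ih =>
      intro hn
      have h1 : γ (n + 1) = (α + 1 + n) * γ n := by
        have : α + 1 + (n : ℝ) ≠ 0 := fun h => hα n (by linarith)
        simp only [hγdef]
        rw [← Real.Gamma_add_one this]
        congr 1; push_cast; ring
      have h2 : α + 1 + (n : ℝ) < 0 := by
        have : (n : ℝ) ≤ k := by exact_mod_cast (by omega : n ≤ k)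
        linarith
      have h3 : (-1) ^ (n + 1) * γ (n + 1) * γ 0 = -(α + 1 + n) * ((-1) ^ n * γ n * γ 0) := by
        rw [h1]; ring
      rw [h3]
      exact mul_pos (by linarith) (ih (by omega))
  have hpos : ∀ n, n ≤ k + 1 → 0 ≤ (-1) ^ n * pairNorm α F₁ F₂ n * γ 0 := by
    intro n hn
    have h1 := pairNorm_mul_nonneg hα hadm n
    rw [moment_laguerre_sq hα] at h1
    have h2 : 0 ≤ pairNorm α F₁ F₂ n * γ n := by
      have hfac : (0 : ℝ) < n.factorial := by positivity
      have : pairNorm α F₁ F₂ n * γ n =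
          pairNorm α F₁ F₂ n * (Real.Gamma (α + 1 + n) / n.factorial) * n.factorial := by
        rw [mul_assoc, div_mul_cancel₀ _ hfac.ne']
      rw [this]
      exact mul_nonneg h1 hfac.le
    have h3 := mul_nonneg h2 (hsign n hn).le
    have h4 : pairNorm α F₁ F₂ n * γ n * ((-1) ^ n * γ n * γ 0) =
        ((-1) ^ n * pairNorm α F₁ F₂ n * γ 0) * (γ n * γ n) := by ring
    rw [h4] at h3
    exact nonneg_of_mul_nonneg_left h3 (mul_self_pos.mpr (hγ n))
  -- `P` has degree at most `k`, so its difference of order `k + 1` vanishes; yet by the alternation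
  -- all terms of that sum have one sign.
  set P : ℝ[X] := (∏ f ∈ F₁, (X - C (f : ℝ))) * ∏ f ∈ F₂, (X + C (α + 1 + f)) with hP
  have hPe : ∀ n : ℕ, P.eval (n : ℝ) = pairNorm α F₁ F₂ n := by
    intro n
    simp only [hP, eval_mul, eval_prod, eval_sub, eval_add, eval_X, eval_C, pairNorm, add_assoc]
  have hdeg : P.natDegree < k + 1 := by
    refine Nat.lt_succ_of_le (natDegree_mul_le.trans (add_le_add ?_ ?_))
    · refine (natDegree_prod_le _ _).trans ((Finset.sum_le_sum (g := fun _ => 1) ?_).trans (by simp))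
      exact fun f _ => (natDegree_X_sub_C _).le
    · refine (natDegree_prod_le _ _).trans ((Finset.sum_le_sum (g := fun _ => 1) ?_).trans (by simp))
      exact fun f _ => (natDegree_X_add_C _).le
  have hsum := congrFun (Polynomial.fwdDiff_iter_eq_zero_of_degree_lt hdeg) 0
  rw [fwdDiff_iter_eq_sum_shift] at hsum
  have hsum2 : ∑ n ∈ Finset.range (k + 1 + 1),
      ((k + 1).choose n : ℝ) * ((-1) ^ n * pairNorm α F₁ F₂ n * γ 0) = 0 := by
    have h1 := congrArg (fun t => (-1) ^ (k + 1) * γ 0 * t) hsum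
    simp only [Finset.mul_sum, Pi.zero_apply, mul_zero] at h1
    rw [← h1]
    refine Finset.sum_congr rfl fun n hn => ?_
    have hn' : n ≤ k + 1 := by simp at hn; omega
    have h2 : ((-1 : ℝ)) ^ (k + 1) * (-1) ^ (k + 1 - n) = (-1) ^ n := by
      obtain ⟨m, hm⟩ := Nat.exists_eq_add_of_le hn'
      rw [hm, Nat.add_sub_cancel_left, pow_add, mul_assoc, ← mul_pow]; simp
    rw [zero_add, nsmul_eq_mul, mul_one, hPe, zsmul_eq_mul]
    push_cast
    rw [← h2]; ring
  -- All terms vanish, and the term `n = 0` would put `0` in `F₁`.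
  have h0 := (Finset.sum_eq_zero_iff_of_nonneg fun n hn =>
    mul_nonneg (Nat.cast_nonneg _) (hpos n (by simp at hn; omega))).mp hsum2 0 (by simp)
  simp only [Nat.choose_zero_right, Nat.cast_one, one_mul, pow_zero] at h0
  rcases mul_eq_zero.mp h0 with h | h
  · exact absurd (hF₁ 0 ((pairNorm_eq_zero_iff hα 0).mp h)) (lt_irrefl 0)
  · exact hγ 0 h

end Pair

/-! ### Determinacy and density -/

/-- The complex moment generating functions are analytic on the strip `|Re z| < t` and have the same
Taylor series at `0`. They agree on the imaginary axis, where they are the characteristic functions.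
-/
lemma measure_ext_of_moments {μ ν : Measure ℝ} [IsFiniteMeasure μ] [IsFiniteMeasure ν] {t : ℝ}
    (ht : 0 < t) (hμ : Integrable (fun x => Real.exp (t * |x|)) μ)
    (hν : Integrable (fun x => Real.exp (t * |x|)) ν)
    (h : ∀ n : ℕ, ∫ x, x ^ n ∂μ = ∫ x, x ^ n ∂ν) : μ = ν := by
  have hset : ∀ ρ : Measure ℝ, Integrable (fun x => Real.exp (t * |x|)) ρ →
      Set.Ioo (-t) t ⊆ interior (ProbabilityTheory.integrableExpSet id ρ) := by
    intro ρ hρ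
    refine interior_maximal (fun s hs => ?_) isOpen_Ioo
    refine hρ.mono' (by fun_prop) (ae_of_all _ fun x => ?_)
    rw [Real.norm_eq_abs, Real.abs_exp, id, Real.exp_le_exp]
    calc s * x ≤ |s * x| := le_abs_self _
      _ = |s| * |x| := abs_mul _ _
      _ ≤ t * |x| := by gcongr; exact (abs_lt.mpr hs).le
  set U : Set ℂ := {z | z.re ∈ Set.Ioo (-t) t} with hU
  have han : ∀ ρ : Measure ℝ, Integrable (fun x => Real.exp (t * |x|)) ρ →
      AnalyticOnNhd ℂ (ProbabilityTheory.complexMGF id ρ) U := fun ρ hρ =>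
    ProbabilityTheory.analyticOnNhd_complexMGF.mono fun z hz => hset ρ hρ hz
  have hUc : IsPreconnected U :=
    ((convex_Ioo (-t) t).linear_preimage Complex.reLm).isPreconnected
  have h0 : (0 : ℂ) ∈ U := by simp [hU, ht]
  have hmom : ∀ ρ : Measure ℝ, Integrable (fun x => Real.exp (t * |x|)) ρ → ∀ n,
      iteratedDeriv n (ProbabilityTheory.complexMGF id ρ) 0 = ((∫ x, x ^ n ∂ρ : ℝ) : ℂ) := by
    intro ρ hρ n
    rw [ProbabilityTheory.iteratedDeriv_complexMGF (hset ρ hρ h0), ← integral_complex_ofReal]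
    simp
  have hev : ProbabilityTheory.complexMGF id μ =ᶠ[nhds 0] ProbabilityTheory.complexMGF id ν := by
    have h1 := (han μ hμ 0 h0).hasFPowerSeriesAt
    have h2 := (han ν hν 0 h0).hasFPowerSeriesAt
    simp only [hmom μ hμ, h] at h1
    simp only [hmom ν hν] at h2
    have h3 := h1.sub h2
    rw [sub_self] at h3
    filter_upwards [h3.eventually_eq_zero] with z hz
    exact sub_eq_zero.mp hz
  have heq := (han μ hμ).eqOn_of_preconnected_of_eventuallyEq (han ν hν) hUc h0 hev
  apply Measure.ext_of_charFun
  ext s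
  rw [← ProbabilityTheory.complexMGF_id_mul_I, ← ProbabilityTheory.complexMGF_id_mul_I]
  exact heq (by simp [hU, ht])

/-- A density with exponential decay all of whose moments vanish is zero. -/
lemma ae_eq_zero_of_moments {μ : Measure ℝ} {G : ℝ → ℝ} {t : ℝ} (ht : 0 < t)
    (hGm : AEStronglyMeasurable G μ)
    (hG : Integrable (fun x => G x * Real.exp (t * |x|)) μ)
    (hm : ∀ n : ℕ, ∫ x, x ^ n * G x ∂μ = 0) : G =ᵐ[μ] 0 := by
  have hdom : ∀ n : ℕ, Integrable (fun x => x ^ n * G x) μ := by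
    intro n
    refine (hG.norm.const_mul (n.factorial / t ^ n)).mono' (by fun_prop) (ae_of_all _ fun x => ?_)
    have h1 : (t * |x|) ^ n / n.factorial ≤ Real.exp (t * |x|) :=
      Real.pow_div_factorial_le_exp _ (by positivity) n
    have hf : (0 : ℝ) < n.factorial := by positivity
    rw [div_le_iff₀ hf, mul_pow] at h1
    rw [norm_mul, norm_mul, norm_pow, Real.norm_eq_abs, Real.norm_eq_abs, Real.norm_eq_abs,
      Real.abs_exp]
    have h2 : |x| ^ n ≤ n.factorial / t ^ n * Real.exp (t * |x|) := by
      rw [div_mul_eq_mul_div, le_div_iff₀ (by positivity)]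
      linarith
    calc |x| ^ n * |G x| ≤ (n.factorial / t ^ n * Real.exp (t * |x|)) * |G x| := by gcongr
      _ = _ := by ring
  have hGi : Integrable G μ := by simpa using hdom 0
  -- Applied to `G` and `-G`: the positive and negative parts of `G` are densities of two finite
  -- measures with equal moments.
  have key : ∀ f : ℝ → ℝ, AEStronglyMeasurable f μ → (∀ x, |f x| ≤ |G x|) →
      IsFiniteMeasure (μ.withDensity fun x => ENNReal.ofReal (f x)) ∧
      Integrable (fun x => Real.exp (t * |x|)) (μ.withDensity fun x => ENNReal.ofReal (f x)) ∧
      ∀ n : ℕ, Integrable (fun x => x ^ n * max (f x) 0) μ ∧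
        ∫ x, x ^ n ∂(μ.withDensity fun x => ENNReal.ofReal (f x)) =
          ∫ x, x ^ n * max (f x) 0 ∂μ := by
    intro f hfm hf
    have hmax : ∀ x, |max (f x) 0| ≤ |G x| := fun x => by
      refine le_trans ?_ (hf x)
      rcases le_total (f x) 0 with h | h
      · simp [h]
      · simp [h]
    have hfi : Integrable f μ := hGi.norm.mono' hfm (ae_of_all _ fun x => by
      simpa [Real.norm_eq_abs] using hf x)
    have hme : AEMeasurable (fun x => (f x).toNNReal) μ := hfm.aemeasurable.real_toNNReal
    refine ⟨isFiniteMeasure_withDensity_ofReal hfi.2, ?_, fun n => ⟨?_, ?_⟩⟩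
    · refine (integrable_withDensity_iff_integrable_smul₀ hme).mpr ?_
      refine hG.norm.mono' ?_ (ae_of_all _ fun x => ?_)
      · have : AEStronglyMeasurable (fun x => Real.exp (t * |x|)) μ := by fun_prop
        exact hme.aestronglyMeasurable.smul this
      · rw [NNReal.smul_def, Real.coe_toNNReal', smul_eq_mul, norm_mul, norm_mul]
        gcongr
        exact hmax x
    · refine (hdom n).norm.mono' (by fun_prop) (ae_of_all _ fun x => ?_)
      rw [norm_mul, norm_mul]
      gcongr
      exact hmax x
    · have := integral_withDensity_eq_integral_smul₀ hme (fun x : ℝ => x ^ n)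
      refine this.trans (integral_congr_ae (ae_of_all _ fun x => ?_))
      simp only [NNReal.smul_def, Real.coe_toNNReal', smul_eq_mul, mul_comm]
  obtain ⟨f1, e1, m1⟩ := key G hGm fun x => le_rfl
  obtain ⟨f2, e2, m2⟩ := key (fun x => -G x) hGm.neg fun x => (abs_neg _).le
  have hmeas := measure_ext_of_moments ht e1 e2 fun n => by
    rw [(m1 n).2, (m2 n).2, ← sub_eq_zero, ← integral_sub (m1 n).1 (m2 n).1]
    refine Eq.trans ?_ (hm n)
    refine integral_congr_ae (ae_of_all _ fun x => ?_)
    simp only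
    rcases le_total (G x) 0 with h | h
    · rw [max_eq_right h, max_eq_left (by linarith)]; ring
    · rw [max_eq_left h, max_eq_right (by linarith)]; ring
  have hneg : AEMeasurable (fun x => ENNReal.ofReal (-G x)) μ := hGm.aemeasurable.neg.ennreal_ofReal
  rw [withDensity_eq_iff hGm.aemeasurable.ennreal_ofReal hneg] at hmeas
  · filter_upwards [hmeas] with x hx
    simp only [Pi.zero_apply]
    rcases lt_trichotomy (G x) 0 with h | h | h
    · rw [ENNReal.ofReal_of_nonpos h.le] at hx
      have := ENNReal.ofReal_pos.mpr (show 0 < -G x by linarith)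
      rw [← hx] at this
      exact absurd this (lt_irrefl _)
    · exact h
    · rw [ENNReal.ofReal_of_nonpos (show -G x ≤ 0 by linarith)] at hx
      have := ENNReal.ofReal_pos.mpr h
      rw [hx] at this
      exact absurd this (lt_irrefl _)
  · exact (hGi.lintegral_lt_top).ne

/-- The measure `μ` has all polynomials times `e^{|x|/4}` in `L²`. -/
def ExpSquareIntegrable (μ : Measure ℝ) : Prop :=
  ∀ q : ℝ[X], MemLp (fun x => q.eval x * Real.exp (1 / 4 * |x|)) 2 μ

lemma ExpSquareIntegrable.memLp {μ : Measure ℝ} (hμ : ExpSquareIntegrable μ) (q : ℝ[X]) :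
    MemLp (fun x => q.eval x) 2 μ := by
  refine (hμ q).mono q.continuous.aestronglyMeasurable (ae_of_all _ fun x => ?_)
  rw [norm_mul, Real.norm_eq_abs (Real.exp _), Real.abs_exp]
  exact le_mul_of_one_le_right (norm_nonneg _) (Real.one_le_exp (by positivity))

/-- Polynomials as elements of `L²(μ)`. -/
def polyLp {μ : Measure ℝ} (hμ : ExpSquareIntegrable μ) : ℝ[X] →ₗ[ℝ] Lp ℝ 2 μ where
  toFun q := (hμ.memLp q).toLp _
  map_add' p q := by
    rw [← MemLp.toLp_add]
    congr 1
    ext x; simp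
  map_smul' r q := by
    rw [RingHom.id_apply, ← MemLp.toLp_const_smul]
    congr 1
    ext x; simp

lemma coeFn_polyLp {μ : Measure ℝ} (hμ : ExpSquareIntegrable μ) (q : ℝ[X]) :
    polyLp hμ q =ᵐ[μ] fun x => q.eval x := (hμ.memLp q).coeFn_toLp

lemma ae_eval_ne_zero (μ : Measure ℝ) [NullSingletonClass μ] {Q : ℝ[X]} (hQ : Q ≠ 0) :
    ∀ᵐ x ∂μ, Q.eval x ≠ 0 := by
  have hfin : {x | Q.eval x = 0}.Finite := by
    refine (Q.roots.toFinset.finite_toSet).subset fun x hx => ?_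
    simp only [Finset.mem_coe, Multiset.mem_toFinset]
    exact (mem_roots hQ).mpr hx
  have := hfin.measure_zero μ
  rw [ae_iff]
  simpa using this

/-- Multiplication of an `L²` function by a polynomial gives a density with exponential decay. -/
lemma ExpSquareIntegrable.integrable_mul {μ : Measure ℝ} (hμ : ExpSquareIntegrable μ)
    {g : ℝ → ℝ} (hg : MemLp g 2 μ) (q : ℝ[X]) :
    Integrable (fun x => g x * q.eval x * Real.exp (1 / 4 * |x|)) μ := by
  have := hg.integrable_mul (hμ q)
  refine this.congr (ae_of_all _ fun x => ?_)
  simp only [Pi.mul_apply]; ring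

lemma eq_of_forall_integral_mul_eq {μ : Measure ℝ} (hμ : ExpSquareIntegrable μ)
    {g : ℝ → ℝ} (hg : MemLp g 2 μ) (P Q : ℝ[X])
    (h : ∀ n : ℕ, ∫ x, g x * (Q * X ^ n).eval x ∂μ = ∫ x, (P * X ^ n).eval x ∂μ) :
    (fun x => g x * Q.eval x) =ᵐ[μ] fun x => P.eval x := by
  have h1 : MemLp (fun _ : ℝ => (1 : ℝ)) 2 μ := by simpa using hμ.memLp 1
  have hint : ∀ q : ℝ[X], ∀ f : ℝ → ℝ, MemLp f 2 μ → Integrable (fun x => f x * q.eval x) μ :=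
    fun q f hf => hf.integrable_mul (hμ.memLp q)
  have hz := ae_eq_zero_of_moments (μ := μ) (G := fun x => g x * Q.eval x - P.eval x)
    (t := 1 / 4) (by norm_num)
    ((hg.1.mul Q.continuous.aestronglyMeasurable).sub P.continuous.aestronglyMeasurable) ?_ ?_
  · filter_upwards [hz] with x hx
    exact sub_eq_zero.mp hx
  · refine ((hμ.integrable_mul hg Q).sub (hμ.integrable_mul h1 P)).congr (ae_of_all _ fun x => ?_)
    simp only [Pi.sub_apply]; ring
  · intro n
    have e1 := hint (Q * X ^ n) g hg
    have e2 := hint (P * X ^ n) _ h1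
    simp only [one_mul] at e2
    rw [← sub_eq_zero.mpr (h n), ← integral_sub e1 e2]
    refine integral_congr_ae (ae_of_all _ fun x => ?_)
    simp only [eval_mul, eval_pow, eval_X]; ring

lemma inner_polyLp {μ : Measure ℝ} (hμ : ExpSquareIntegrable μ) (g : Lp ℝ 2 μ) (q : ℝ[X]) :
    inner ℝ g (polyLp hμ q) = ∫ x, g x * q.eval x ∂μ := by
  rw [L2.inner_def]
  refine integral_congr_ae ?_
  filter_upwards [coeFn_polyLp hμ q] with x hx
  rw [hx]
  simp [mul_comm]

/-- The multiples of a nonzero polynomial are dense in `L²(μ)`. -/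
lemma denseRange_polyLp_mul {μ : Measure ℝ} [NullSingletonClass μ] (hμ : ExpSquareIntegrable μ) {Q : ℝ[X]}
    (hQ : Q ≠ 0) : DenseRange ((polyLp hμ).comp (LinearMap.mulLeft ℝ Q)) := by
  rw [DenseRange, ← LinearMap.coe_range, Submodule.dense_iff_topologicalClosure_eq_top,
    Submodule.topologicalClosure_eq_top_iff, Submodule.eq_bot_iff]
  intro g hg
  rw [Submodule.mem_orthogonal'] at hg
  have h1 := eq_of_forall_integral_mul_eq hμ (Lp.memLp g) 0 Q fun n => by
    have := hg _ (LinearMap.mem_range_self _ (X ^ n))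
    rw [LinearMap.comp_apply, inner_polyLp] at this
    simpa using this
  rw [Lp.eq_zero_iff_ae_eq_zero]
  filter_upwards [h1, ae_eval_ne_zero μ hQ] with x hx hx'
  simpa [hx'] using hx

/-- If `s ↦ ∫ P s` is bounded with respect to the `L²` norm of `Q s`, then `P / Q` is in `L²`. -/
lemma exists_memLp_of_bounded {μ : Measure ℝ} [NullSingletonClass μ] (hμ : ExpSquareIntegrable μ)
    {P Q : ℝ[X]} (hQ : Q ≠ 0) {B : ℝ} (hB : ∀ s : ℝ[X], (∫ x, (P * s).eval x ∂μ) ^ 2 ≤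
      B * ∫ x, ((Q * s).eval x) ^ 2 ∂μ) :
    ∃ g : ℝ → ℝ, MemLp g 2 μ ∧ (fun x => g x * Q.eval x) =ᵐ[μ] fun x => P.eval x := by
  have h1 : MemLp (fun _ : ℝ => (1 : ℝ)) 2 μ := by simpa using hμ.memLp 1
  have hint : ∀ q : ℝ[X], Integrable (fun x => q.eval x) μ := fun q =>
    (h1.integrable_mul (hμ.memLp q)).congr (ae_of_all _ fun x => by simp)
  let f : ℝ[X] →ₗ[ℝ] ℝ :=
    { toFun := fun s => ∫ x, (P * s).eval x ∂μ
      map_add' := fun s t => by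
        rw [← integral_add (hint _) (hint _)]
        simp only [mul_add, eval_add]
      map_smul' := fun r s => by
        rw [RingHom.id_apply, smul_eq_mul, ← integral_const_mul]
        simp only [mul_smul_comm, eval_smul, smul_eq_mul] }
  set e := (polyLp hμ).comp (LinearMap.mulLeft ℝ Q) with he
  have hd : DenseRange e := denseRange_polyLp_mul hμ hQ
  have hnorm : ∀ s, ‖e s‖ ^ 2 = ∫ x, ((Q * s).eval x) ^ 2 ∂μ := by
    intro s
    rw [← real_inner_self_eq_norm_sq]
    simp only [he, LinearMap.comp_apply, LinearMap.mulLeft_apply]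
    rw [inner_polyLp]
    refine integral_congr_ae ?_
    filter_upwards [coeFn_polyLp hμ (Q * s)] with x hx
    rw [hx, sq]
  have hbound : ∃ C, ∀ s, ‖f s‖ ≤ C * ‖e s‖ := by
    refine ⟨√(max B 0), fun s => ?_⟩
    rw [Real.norm_eq_abs]
    refine abs_le_of_sq_le_sq ?_ (by positivity)
    rw [mul_pow, Real.sq_sqrt (le_max_right _ _), hnorm]
    refine (hB s).trans ?_
    exact mul_le_mul_of_nonneg_right (le_max_left _ _) (integral_nonneg fun x => sq_nonneg _)
  -- The functional `Q s ↦ ∫ P s` extends from the dense range of `e`; its Riesz representative `g`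
  -- satisfies `∫ g Q s = ∫ P s`, and determinacy gives `g Q = P`.
  set ℓ := f.extendOfNorm e
  refine ⟨((InnerProductSpace.toDual ℝ (Lp ℝ 2 μ)).symm ℓ : Lp ℝ 2 μ), Lp.memLp _, ?_⟩
  refine eq_of_forall_integral_mul_eq hμ (Lp.memLp _) P Q fun n => ?_
  rw [← inner_polyLp hμ, InnerProductSpace.toDual_symm_apply]
  exact LinearMap.extendOfNorm_eq hd hbound (X ^ n)

/-! ### Densities on the half line -/

section Density

variable {h : ℝ → ℝ}

lemma ae_toNNReal_smul (hpos : ∀ x, 0 < x → 0 ≤ h x) (f : ℝ → ℝ) :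
    (fun x => (h x).toNNReal • f x) =ᵐ[volume.restrict (Set.Ioi 0)] fun x => h x * f x := by
  filter_upwards [ae_restrict_mem measurableSet_Ioi] with x hx
  rw [NNReal.smul_def, Real.coe_toNNReal _ (hpos x hx), smul_eq_mul]

lemma integrable_halfLine_iff (hm : Measurable h) (hpos : ∀ x, 0 < x → 0 ≤ h x) (f : ℝ → ℝ) :
    Integrable f ((volume.restrict (Set.Ioi 0)).withDensity fun x => ENNReal.ofReal (h x)) ↔
      IntegrableOn (fun x => h x * f x) (Set.Ioi 0) :=
  (integrable_withDensity_iff_integrable_smul₀ hm.real_toNNReal.aemeasurable).trans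
    (integrable_congr (ae_toNNReal_smul hpos f))

lemma integral_halfLine (hm : Measurable h) (hpos : ∀ x, 0 < x → 0 ≤ h x) (f : ℝ → ℝ) :
    ∫ x, f x ∂((volume.restrict (Set.Ioi 0)).withDensity fun x => ENNReal.ofReal (h x)) =
      ∫ x in Set.Ioi 0, h x * f x :=
  (integral_withDensity_eq_integral_smul₀ hm.real_toNNReal.aemeasurable f).trans
    (integral_congr_ae (ae_toNNReal_smul hpos f))

lemma nullSingleton_halfLine (h : ℝ → ℝ) : NullSingletonClass
    ((volume.restrict (Set.Ioi (0 : ℝ))).withDensity fun x => ENNReal.ofReal (h x)) :=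
  ⟨fun x => withDensity_absolutelyContinuous _ _ (measure_singleton x)⟩

end Density

/-- The measure `x^β e^{-x} dx` on `(0, ∞)`. -/
def gammaMeasure (β : ℝ) : Measure ℝ :=
  (volume.restrict (Set.Ioi 0)).withDensity fun x => ENNReal.ofReal (x ^ β * Real.exp (-x))

instance (β : ℝ) : NullSingletonClass (gammaMeasure β) := nullSingleton_halfLine _

lemma measurable_gammaDensity (β : ℝ) : Measurable fun x : ℝ => x ^ β * Real.exp (-x) := by
  fun_prop

lemma gammaDensity_nonneg (β : ℝ) (x : ℝ) (hx : 0 < x) : 0 ≤ x ^ β * Real.exp (-x) := by positivity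

lemma integrable_gammaMeasure_iff (β : ℝ) (f : ℝ → ℝ) : Integrable f (gammaMeasure β) ↔
    IntegrableOn (fun x => x ^ β * Real.exp (-x) * f x) (Set.Ioi 0) :=
  integrable_halfLine_iff (measurable_gammaDensity β) (gammaDensity_nonneg β) f

lemma integral_gammaMeasure (β : ℝ) (f : ℝ → ℝ) : ∫ x, f x ∂(gammaMeasure β) =
    ∫ x in Set.Ioi 0, x ^ β * Real.exp (-x) * f x :=
  integral_halfLine (measurable_gammaDensity β) (gammaDensity_nonneg β) f

lemma integrableOn_rpow_mul_exp_mul_eval {β b : ℝ} (hβ : -1 < β) (hb : 0 < b) (q : ℝ[X]) :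
    IntegrableOn (fun x => x ^ β * Real.exp (-b * x) * q.eval x) (Set.Ioi 0) := by
  induction q using Polynomial.induction_on' with
  | add p q hp hq =>
    refine (hp.add hq).congr_fun (fun x _ => ?_) measurableSet_Ioi
    simp only [Pi.add_apply, eval_add]; ring
  | monomial n a =>
    have h := integrableOn_rpow_mul_exp_neg_mul_rpow (p := 1) (s := β + n) (b := b)
      (by have : (0 : ℝ) ≤ n := Nat.cast_nonneg n
          linarith) one_pos hb
    refine IntegrableOn.congr_fun (h.const_mul a) (fun x hx => ?_) measurableSet_Ioi
    simp only [Real.rpow_one, eval_monomial]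
    rw [Real.rpow_add hx, Real.rpow_natCast]
    ring

lemma expSquareIntegrable_gammaMeasure {β : ℝ} (hβ : -1 < β) :
    ExpSquareIntegrable (gammaMeasure β) := by
  intro q
  rw [memLp_two_iff_integrable_sq (by fun_prop), integrable_gammaMeasure_iff]
  -- The square of `e^{x/4}` costs half of the decay, which leaves `e^{-x/2}`.
  refine IntegrableOn.congr_fun (integrableOn_rpow_mul_exp_mul_eval hβ (b := 1 / 2) (by norm_num)
    (q ^ 2)) (fun x hx => ?_) measurableSet_Ioi
  simp only [eval_pow, mul_pow]
  rw [abs_of_pos hx, ← Real.exp_nat_mul,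
    show -(1 / 2) * x = -x + ((2 : ℕ) : ℝ) * (1 / 4 * x) by push_cast; ring, Real.exp_add]
  ring

lemma moment_X_pow_mul {α : ℝ} {k : ℕ} (hβ : -1 < α + k) (q : ℝ[X]) :
    moment α (X ^ k * q) = ∫ x, q.eval x ∂(gammaMeasure (α + k)) := by
  have hint : ∀ q : ℝ[X], Integrable (fun x => q.eval x) (gammaMeasure (α + k)) := fun q => by
    rw [integrable_gammaMeasure_iff]
    simpa using integrableOn_rpow_mul_exp_mul_eval hβ one_pos q
  induction q using Polynomial.induction_on' with
  | add p q hp hq =>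
    rw [mul_add, map_add, hp, hq, ← integral_add (hint _) (hint _)]
    simp only [eval_add]
  | monomial n a =>
    rw [X_pow_mul_monomial, moment_monomial, integral_gammaMeasure, Real.Gamma_eq_integral,
      ← integral_const_mul]
    · refine setIntegral_congr_fun measurableSet_Ioi fun x hx => ?_
      simp only [eval_monomial]
      rw [show α + 1 + ((n + k : ℕ) : ℝ) - 1 = α + k + n by push_cast; ring, Real.rpow_add hx,
        Real.rpow_natCast]
      ring
    · push_cast
      have : (0 : ℝ) ≤ n := Nat.cast_nonneg n
      linarith

/-! ### Absence of zeros -/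

/-- Otherwise `(P / Q)²` has a pole of order at least two at `x₀`, where the weight is positive, and
is not integrable there. -/
lemma pow_dvd_of_memLp {β x₀ : ℝ} (hx₀ : 0 < x₀) {P Q : ℝ[X]} (hQ : Q ≠ 0) {g : ℝ → ℝ}
    (hg : MemLp g 2 (gammaMeasure β))
    (h : (fun x => g x * Q.eval x) =ᵐ[gammaMeasure β] fun x => P.eval x) :
    (X - C x₀) ^ rootMultiplicity x₀ Q ∣ P := by
  by_cases hP : P = 0
  · simp [hP]
  by_contra hdvd
  obtain ⟨P', hP', hP'd⟩ := exists_eq_pow_rootMultiplicity_mul_and_not_dvd P hP x₀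
  obtain ⟨Q', hQ', hQ'd⟩ := exists_eq_pow_rootMultiplicity_mul_and_not_dvd Q hQ x₀
  set m := rootMultiplicity x₀ Q with hm
  set a := rootMultiplicity x₀ P with ha
  have ham : a < m := by
    by_contra hcon
    apply hdvd
    rw [hP']
    exact (pow_dvd_pow _ (not_lt.mp hcon)).mul_right _
  have hP0 : P'.eval x₀ ≠ 0 := fun h => hP'd (dvd_iff_isRoot.mpr h)
  have hQ0 : Q'.eval x₀ ≠ 0 := fun h => hQ'd (dvd_iff_isRoot.mpr h)
  set F : ℝ → ℝ := fun x => x ^ β * Real.exp (-x) * (P.eval x / Q.eval x) ^ 2 with hF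
  have hint : IntegrableOn F (Set.Ioi 0) := by
    rw [hF, ← integrable_gammaMeasure_iff]
    refine (hg.integrable_sq).congr ?_
    filter_upwards [h, ae_eval_ne_zero (gammaMeasure β) hQ] with x hx hx'
    rw [← hx, mul_div_cancel_right₀ _ hx']
  have hii : IntervalIntegrable F volume (x₀ / 2) (x₀ + 1) := by
    rw [intervalIntegrable_iff_integrableOn_Ioc_of_le (by linarith)]
    exact hint.mono_set fun x hx => lt_trans (by linarith : 0 < x₀ / 2) hx.1
  refine not_intervalIntegrable_of_sub_inv_isBigO_punctured ?_ (by linarith) ?_ hii (c := x₀)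
  · set ψ : ℝ → ℝ := fun x => x ^ β * Real.exp (-x) * (P'.eval x / Q'.eval x) ^ 2 with hψ
    have hψc : ContinuousAt ψ x₀ := by
      have h1 : ContinuousAt (fun x : ℝ => x ^ β) x₀ :=
        Real.continuousAt_rpow_const _ _ (Or.inl hx₀.ne')
      exact (h1.mul (Real.continuous_exp.comp continuous_neg).continuousAt).mul
        ((P'.continuous.continuousAt.div Q'.continuous.continuousAt hQ0).pow 2)
    have hψ0 : 0 < ψ x₀ := by
      have : 0 < (P'.eval x₀ / Q'.eval x₀) ^ 2 := by positivity
      simp only [hψ]; positivity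
    have hev : ∀ᶠ x in nhdsWithin x₀ {x₀}ᶜ, ψ x₀ / 2 < ψ x ∧ |x - x₀| < 1 := by
      refine nhdsWithin_le_nhds (Filter.Eventually.and ?_ ?_)
      · exact hψc.eventually_const_lt (by linarith)
      · have : Filter.Tendsto (fun x => |x - x₀|) (nhds x₀) (nhds |x₀ - x₀|) :=
          (continuous_abs.comp (continuous_id.sub continuous_const)).tendsto x₀
        rw [sub_self, abs_zero] at this
        exact this.eventually_lt_const one_pos
    -- The constant comes from `ψ > ψ x₀ / 2` near `x₀`.
    refine Asymptotics.IsBigO.of_bound (2 / ψ x₀) ?_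
    filter_upwards [hev, self_mem_nhdsWithin] with x hx hxne
    have hne : x - x₀ ≠ 0 := sub_ne_zero.mpr hxne
    obtain ⟨l, hl⟩ := Nat.exists_eq_add_of_lt ham
    have hFx : F x = ψ x * ((x - x₀)⁻¹) ^ (2 * (l + 1)) := by
      simp only [hF, hψ]
      rw [hP', hQ', hl]
      simp only [eval_mul, eval_pow, eval_sub, eval_X, eval_C]
      by_cases hq : Q'.eval x = 0
      · simp [hq]
      · rw [show a + l + 1 = a + (l + 1) by ring, pow_add, inv_pow, mul_comm 2 (l + 1), pow_mul]
        field_simp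
    have h1 : 1 ≤ |x - x₀|⁻¹ := (one_le_inv₀ (abs_pos.mpr hne)).mpr hx.2.le
    rw [hFx, norm_mul, norm_pow, norm_inv, Real.norm_eq_abs (x - x₀),
      Real.norm_of_nonneg (show 0 ≤ ψ x by linarith [hx.1])]
    have h2 : |x - x₀|⁻¹ ≤ (|x - x₀|⁻¹) ^ (2 * (l + 1)) :=
      le_self_pow₀ h1 (by omega)
    have h3 : 1 ≤ 2 / ψ x₀ * ψ x := by
      rw [div_mul_eq_mul_div, le_div_iff₀ hψ0]; linarith [hx.1]
    calc |x - x₀|⁻¹ ≤ 1 * (|x - x₀|⁻¹) ^ (2 * (l + 1)) := by rw [one_mul]; exact h2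
      _ ≤ (2 / ψ x₀ * ψ x) * (|x - x₀|⁻¹) ^ (2 * (l + 1)) := by gcongr
      _ = _ := by ring
  · rw [Set.uIcc_of_le (by linarith)]
    constructor <;> linarith

/-- On `X ^ j` the terms of order above `j` vanish, those below are divisible by induction, and the
one of order `j` is `j! c_j`. -/
lemma dvd_coeff_of_forall_dvd_diffOp {d : ℝ[X]} {k : ℕ} {c : ℕ → ℝ[X]}
    (h : ∀ p, d ∣ diffOp polyD k c p) {j : ℕ} (hj : j ≤ k) : d ∣ c j := by
  induction j using Nat.strong_induction_on with
  | _ j ih =>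
    have h1 := h (X ^ j)
    rw [diffOp_apply, ← Finset.sum_range_add_sum_Ico _ (show j + 1 ≤ k + 1 by omega),
      Finset.sum_range_succ] at h1
    have h2 : ∑ i ∈ Finset.Ico (j + 1) (k + 1), c i * polyD^[i] (X ^ j) = 0 := by
      refine Finset.sum_eq_zero fun i hi => ?_
      have : polyD^[i] (X ^ j : ℝ[X]) = 0 := by
        change derivative^[i] (X ^ j) = 0
        refine iterate_derivative_eq_zero ?_
        rw [natDegree_X_pow]
        simp only [Finset.mem_Ico] at hi
        omega
      rw [this, mul_zero]
    have h3 : d ∣ ∑ i ∈ Finset.range j, c i * polyD^[i] (X ^ j) :=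
      Finset.dvd_sum fun i hi => (ih i (by simpa using hi)
        (by simp only [Finset.mem_range] at hi; omega)).mul_right _
    rw [h2, add_zero] at h1
    have h4 := (dvd_add_right h3).mp h1
    have h5 : polyD^[j] (X ^ j : ℝ[X]) = C (j.factorial : ℝ) := by
      change derivative^[j] (X ^ j) = _
      rw [iterate_derivative_X_pow_eq_natCast_mul]
      simp [Nat.descFactorial_self]
    rw [h5] at h4
    have hu : IsUnit (C (j.factorial : ℝ)) :=
      isUnit_C.mpr (Nat.cast_ne_zero.mpr (Nat.factorial_ne_zero j)).isUnit
    exact hu.dvd_mul_right.mp h4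

section Pair

variable {α : ℝ} {F₁ F₂ : Finset ℕ}

lemma Omega_ne_zero (hα : ∀ j : ℕ, α ≠ -((j : ℝ) + 1)) : Omega α F₁ F₂ ≠ 0 := fun h =>
  coeff_zero_Omega_ne_zero (F₁ := F₁) (F₂ := F₂) hα (by rw [h, coeff_zero])

/-- `Ω` has no zeros on `(0, ∞)`. -/
theorem eval_Omega_ne_zero (hα : ∀ j : ℕ, α ≠ -((j : ℝ) + 1)) (hF₁ : ∀ f ∈ F₁, 0 < f)
    (hk : 0 < F₁.card + F₂.card) (hadm : Admissible (α + 1) F₁ F₂) {x : ℝ} (hx : 0 < x) :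
    (Omega α F₁ F₂).eval x ≠ 0 := by
  intro hroot
  have hβ := neg_one_lt_of_admissible hα hF₁ hadm
  have hΩ := Omega_ne_zero (F₁ := F₁) (F₂ := F₂) hα
  set m := rootMultiplicity x (Omega α F₁ F₂) with hm
  have hm0 : 0 < m := (rootMultiplicity_pos hΩ).mpr hroot
  have hdvd : ∀ p, (X - C x) ^ m ∣ pairOp α F₁ F₂ p := by
    intro p
    obtain ⟨g, hg, hgP⟩ := exists_memLp_of_bounded (expSquareIntegrable_gammaMeasure hβ)
      (P := pairOp α F₁ F₂ p) hΩ (B := moment α (p * pairProd α F₁ F₂ p)) fun s => by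
        have h := moment_pairOp_sq_le hα hadm p s
        rw [moment_X_pow_mul hβ, moment_X_pow_mul hβ] at h
        simpa only [eval_pow] using h
    exact pow_dvd_of_memLp hx hΩ hg hgP
  have h1 : (X - C x) ^ m ∣ pairCoeff α F₁ F₂ (F₁.card + F₂.card - 1) :=
    dvd_coeff_of_forall_dvd_diffOp hdvd (by omega)
  rw [pairCoeff_pred hα hk] at h1
  have hu : IsUnit ((-1 : ℝ[X]) ^ (F₁.card + F₂.card + 1)) := (isUnit_one.neg).pow _
  rw [hu.dvd_mul_left] at h1
  have hΩd : (X - C x) ^ m ∣ Omega α F₁ F₂ := pow_rootMultiplicity_dvd _ _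
  have h2 : (X - C x) ^ m ∣ derivative (Omega α F₁ F₂) :=
    (dvd_add_left (hΩd.mul_left _)).mp h1
  have hne : derivative (Omega α F₁ F₂) ≠ 0 := by
    intro h0
    have hC := derivative_eq_zero.mp h0
    rw [eq_C_of_natDegree_eq_zero hC, eval_C] at hroot
    exact coeff_zero_Omega_ne_zero hα hroot
  have h3 := (le_rootMultiplicity_iff hne).mpr h2
  rw [derivative_rootMultiplicity_of_root hroot] at h3
  omega

end Pair

/-! ### The exceptional weight: orthogonality, norms and density -/

lemma exists_pos_le_abs_eval {Q : ℝ[X]} (hQ : ∀ x : ℝ, 0 ≤ x → Q.eval x ≠ 0) :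
    ∃ δ, 0 < δ ∧ ∀ x : ℝ, 0 ≤ x → δ ≤ |Q.eval x| := by
  obtain ⟨M, hM⟩ : ∃ M : ℝ, ∀ x, M ≤ x → |Q.eval 0| ≤ |Q.eval x| := by
    rcases Nat.eq_zero_or_pos Q.natDegree with h | h
    · refine ⟨0, fun x _ => ?_⟩
      rw [eq_C_of_natDegree_eq_zero h]; simp
    · exact Filter.eventually_atTop.mp
        ((Q.abs_tendsto_atTop (natDegree_pos_iff_degree_pos.mp h)).eventually_ge_atTop _)
  obtain ⟨y, hy, hmin⟩ := (isCompact_Icc (a := (0 : ℝ)) (b := max M 0)).exists_isMinOn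
    ⟨0, by simp⟩ (Q.continuous.abs.continuousOn)
  refine ⟨|Q.eval y|, abs_pos.mpr (hQ y hy.1), fun x hx => ?_⟩
  rcases le_total x (max M 0) with h | h
  · exact hmin ⟨hx, h⟩
  · exact (hmin (show (0 : ℝ) ∈ Set.Icc 0 (max M 0) by simp)).trans
      (hM x ((le_max_left _ _).trans h))

section Pair

variable {α : ℝ} {F₁ F₂ : Finset ℕ}

lemma measurable_weight (α : ℝ) (F₁ F₂ : Finset ℕ) : Measurable (weight α F₁ F₂) := by
  have := (Omega α F₁ F₂).continuous.measurable
  unfold weight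
  fun_prop

lemma weight_nonneg (α : ℝ) (F₁ F₂ : Finset ℕ) (x : ℝ) (hx : 0 < x) : 0 ≤ weight α F₁ F₂ x := by
  unfold weight; positivity

instance (α : ℝ) (F₁ F₂ : Finset ℕ) : NullSingletonClass (weightMeasure α F₁ F₂) :=
  nullSingleton_halfLine _

lemma integrable_weightMeasure_iff (α : ℝ) (F₁ F₂ : Finset ℕ) (f : ℝ → ℝ) :
    Integrable f (weightMeasure α F₁ F₂) ↔
      IntegrableOn (fun x => weight α F₁ F₂ x * f x) (Set.Ioi 0) :=
  integrable_halfLine_iff (measurable_weight α F₁ F₂) (weight_nonneg α F₁ F₂) f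

lemma integral_weightMeasure (α : ℝ) (F₁ F₂ : Finset ℕ) (f : ℝ → ℝ) :
    ∫ x, f x ∂(weightMeasure α F₁ F₂) = ∫ x in Set.Ioi 0, weight α F₁ F₂ x * f x :=
  integral_halfLine (measurable_weight α F₁ F₂) (weight_nonneg α F₁ F₂) f

lemma integrable_weightMeasure (hΩ : ∀ x : ℝ, 0 ≤ x → (Omega α F₁ F₂).eval x ≠ 0) {f : ℝ → ℝ}
    (hf : Continuous f) (hi : Integrable f (gammaMeasure (α + (F₁.card + F₂.card : ℕ)))) :
    Integrable f (weightMeasure α F₁ F₂) := by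
  obtain ⟨δ, hδ, hle⟩ := exists_pos_le_abs_eval hΩ
  rw [integrable_weightMeasure_iff]
  rw [integrable_gammaMeasure_iff] at hi
  refine Integrable.mono' (hi.norm.const_mul (δ ^ 2)⁻¹)
    ((measurable_weight α F₁ F₂).mul hf.measurable).aestronglyMeasurable ?_
  filter_upwards [ae_restrict_mem measurableSet_Ioi] with x hx
  have hx0 : (0 : ℝ) < x := hx
  rw [norm_mul, norm_mul, ← mul_assoc]
  refine mul_le_mul_of_nonneg_right ?_ (norm_nonneg _)
  rw [Real.norm_of_nonneg (weight_nonneg α F₁ F₂ x hx0),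
    Real.norm_of_nonneg (gammaDensity_nonneg _ x hx0), weight, div_eq_inv_mul]
  refine mul_le_mul_of_nonneg_right ?_ (gammaDensity_nonneg _ x hx0)
  refine inv_anti₀ (by positivity) ?_
  rw [← sq_abs (eval x _)]
  exact pow_le_pow_left₀ hδ.le (hle x hx0.le) 2

lemma expSquareIntegrable_weightMeasure (hΩ : ∀ x : ℝ, 0 ≤ x → (Omega α F₁ F₂).eval x ≠ 0)
    (hβ : -1 < α + (F₁.card + F₂.card : ℕ)) : ExpSquareIntegrable (weightMeasure α F₁ F₂) := by
  intro q
  have hc : Continuous fun x => q.eval x * Real.exp (1 / 4 * |x|) := by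
    have := q.continuous
    fun_prop
  rw [memLp_two_iff_integrable_sq hc.aestronglyMeasurable]
  exact integrable_weightMeasure hΩ (hc.pow 2)
    ((memLp_two_iff_integrable_sq hc.aestronglyMeasurable).mp
      (expSquareIntegrable_gammaMeasure hβ q))

lemma integrable_eval_weightMeasure (hΩ : ∀ x : ℝ, 0 ≤ x → (Omega α F₁ F₂).eval x ≠ 0)
    (hβ : -1 < α + (F₁.card + F₂.card : ℕ)) (q : ℝ[X]) :
    Integrable (fun x => q.eval x) (weightMeasure α F₁ F₂) := by
  have hμ := expSquareIntegrable_weightMeasure hΩ hβ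
  refine ((hμ.memLp 1).integrable_mul (hμ.memLp q)).congr (ae_of_all _ fun x => ?_)
  simp

/-- Orthogonality of transformed Laguerre polynomials. -/
lemma integral_pairOp_mul_pairOp (hα : ∀ j : ℕ, α ≠ -((j : ℝ) + 1))
    (hΩ : ∀ x : ℝ, 0 ≤ x → (Omega α F₁ F₂).eval x ≠ 0)
    (hβ : -1 < α + (F₁.card + F₂.card : ℕ)) {n m : ℕ} (hnm : n ≠ m) :
    ∫ x, (pairOp α F₁ F₂ (laguerre α n)).eval x * (pairOp α F₁ F₂ (laguerre α m)).eval x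
      ∂(weightMeasure α F₁ F₂) = 0 := by
  have hid := pairOp_laguerre_identity (F₁ := F₁) (F₂ := F₂) hα n m _ _ _ _ rfl rfl rfl rfl
  set P := pairOp α F₁ F₂ (laguerre α n)
  set Q := pairOp α F₁ F₂ (laguerre α m)
  set N := derivative P * Q - P * derivative Q
  set Ω := Omega α F₁ F₂ with hΩdef
  set β : ℝ := α + (F₁.card + F₂.card : ℕ) with hβdef
  -- `N / Ω²` is the Wronskian of `P / Ω` and `Q / Ω`, so `F` is the Sturm-Liouville primitive of
  -- `(m - n) P Q` times the weight.
  set F : ℝ → ℝ := fun x => x ^ (β + 1) * Real.exp (-x) * N.eval x / (Ω.eval x) ^ 2 with hF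
  have hderiv : ∀ x ∈ Set.Ioi (0 : ℝ), HasDerivAt F
      (((m : ℝ) - n) * (weight α F₁ F₂ x * (P.eval x * Q.eval x))) x := by
    intro x hx
    have hx0 : (0 : ℝ) < x := hx
    have hΩx : Ω.eval x ≠ 0 := hΩ x hx0.le
    have h1 : HasDerivAt (fun y : ℝ => y ^ (β + 1)) ((β + 1) * x ^ (β + 1 - 1)) x :=
      Real.hasDerivAt_rpow_const (Or.inl hx0.ne')
    have h2 : HasDerivAt (fun y : ℝ => Real.exp (-y)) (Real.exp (-x) * -1) x :=
      (hasDerivAt_neg x).exp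
    have h := ((h1.mul h2).mul (N.hasDerivAt x)).div ((Ω.hasDerivAt x).pow 2)
      (pow_ne_zero 2 hΩx)
    refine h.congr_deriv ?_
    have hidx := congrArg (eval x) hid
    simp only [eval_add, eval_sub, eval_mul, eval_X, eval_C, eval_ofNat] at hidx
    rw [show α + 1 + ((F₁.card + F₂.card : ℕ) : ℝ) = β + 1 by rw [hβdef]; ring] at hidx
    simp only [weight]
    rw [← hβdef, ← hΩdef, add_sub_cancel_right]
    simp only [Pi.mul_apply, Pi.pow_apply, Real.rpow_add_one hx0.ne', Nat.cast_ofNat, Nat.add_one_sub_one, pow_one]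
    field_simp
    linear_combination hidx
  have hint : IntegrableOn (fun x => ((m : ℝ) - n) *
      (weight α F₁ F₂ x * (P.eval x * Q.eval x))) (Set.Ioi 0) := by
    refine Integrable.const_mul ?_ _
    have := (integrable_weightMeasure_iff α F₁ F₂ _).mp
      (integrable_eval_weightMeasure hΩ hβ (P * Q))
    simp only [eval_mul] at this
    exact this
  have hFint : IntegrableOn F (Set.Ioi 0) := by
    have := (integrable_weightMeasure_iff α F₁ F₂ _).mp
      (integrable_eval_weightMeasure hΩ hβ (X * N))
    refine IntegrableOn.congr_fun this (fun x hx => ?_) measurableSet_Ioi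
    simp only [hF, weight, eval_mul, eval_X]
    rw [Real.rpow_add_one (ne_of_gt hx)]
    ring
  -- `F` and its derivative are integrable, so `F` tends to `0` at infinity; at `0` it vanishes
  -- because `β + 1 > 0`.
  have hlim := tendsto_zero_of_hasDerivAt_of_integrableOn_Ioi hderiv hint hFint
  have hcont : ContinuousWithinAt F (Set.Ici 0) 0 := by
    refine ContinuousAt.continuousWithinAt ?_
    have h1 : ContinuousAt (fun y : ℝ => y ^ (β + 1)) 0 :=
      Real.continuousAt_rpow_const _ _ (Or.inr (by linarith))
    exact ((h1.mul (Real.continuous_exp.comp continuous_neg).continuousAt).mul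
      N.continuous.continuousAt).div (Ω.continuous.continuousAt.pow 2)
      (pow_ne_zero 2 (hΩ 0 le_rfl))
  have hfin := integral_Ioi_of_hasDerivAt_of_tendsto hcont hderiv hint hlim
  have hF0 : F 0 = 0 := by
    simp only [hF]
    rw [Real.zero_rpow (by linarith)]; simp
  rw [hF0, sub_zero, integral_const_mul] at hfin
  rw [integral_weightMeasure]
  rcases mul_eq_zero.mp hfin with h | h
  · exact absurd (Nat.cast_injective (R := ℝ) (by linarith)) hnm
  · exact h

lemma weight_pos (hΩ : ∀ x : ℝ, 0 ≤ x → (Omega α F₁ F₂).eval x ≠ 0) {x : ℝ} (hx : 0 < x) :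
    0 < weight α F₁ F₂ x := by
  have := hΩ x hx.le
  unfold weight
  positivity

lemma weightMeasure_ne_zero (hΩ : ∀ x : ℝ, 0 ≤ x → (Omega α F₁ F₂).eval x ≠ 0) :
    weightMeasure α F₁ F₂ ≠ 0 := by
  intro h
  rw [weightMeasure, withDensity_eq_zero_iff
    (measurable_weight α F₁ F₂).ennreal_ofReal.aemeasurable] at h
  have h2 : ∀ᵐ x ∂(volume.restrict (Set.Ioi (0 : ℝ))), False := by
    filter_upwards [h, ae_restrict_mem measurableSet_Ioi] with x hx hx0
    have := ENNReal.ofReal_pos.mpr (weight_pos hΩ hx0)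
    rw [hx] at this
    exact lt_irrefl _ this
  rw [Filter.eventually_false_iff_eq_bot, ae_eq_bot, Measure.restrict_eq_zero] at h2
  simp at h2

lemma integral_eval_sq_pos (hΩ : ∀ x : ℝ, 0 ≤ x → (Omega α F₁ F₂).eval x ≠ 0)
    (hβ : -1 < α + (F₁.card + F₂.card : ℕ)) {q : ℝ[X]} (hq : q ≠ 0) :
    0 < ∫ x, q.eval x ^ 2 ∂(weightMeasure α F₁ F₂) := by
  have hnn : 0 ≤ fun x => q.eval x ^ 2 := fun x => sq_nonneg _
  refine lt_of_le_of_ne (integral_nonneg hnn) fun h => ?_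
  have hi : Integrable (fun x => q.eval x ^ 2) (weightMeasure α F₁ F₂) := by
    have := integrable_eval_weightMeasure hΩ hβ (q ^ 2)
    simp only [eval_pow] at this
    exact this
  have h2 := (integral_eq_zero_iff_of_nonneg hnn hi).mp h.symm
  have h3 : ∀ᵐ x ∂(weightMeasure α F₁ F₂), False := by
    filter_upwards [h2, ae_eval_ne_zero (weightMeasure α F₁ F₂) hq] with x hx hx'
    exact hx' (pow_eq_zero_iff (two_ne_zero) |>.mp hx)
  rw [Filter.eventually_false_iff_eq_bot, ae_eq_bot] at h3
  exact weightMeasure_ne_zero hΩ h3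

/-- Applying `T*` multiplies `L_n^α` by `pairNorm`, which vanishes only on `F₁`. -/
lemma pairOp_laguerre_ne_zero (hα : ∀ j : ℕ, α ≠ -((j : ℝ) + 1)) {n : ℕ} (hn : n ∉ F₁) :
    pairOp α F₁ F₂ (laguerre α n) ≠ 0 := by
  intro h
  have h1 := pairProd_eq_zero_of_pairOp_eq_zero hα h
  rw [pairProd_laguerre, smul_eq_zero, pairNorm_eq_zero_iff hα] at h1
  rcases h1 with h | h
  · exact hn h
  · exact (laguerreSeq α).ne_zero n h

lemma pairOp_mem_span (hα : ∀ j : ℕ, α ≠ -((j : ℝ) + 1)) (r : ℝ[X]) :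
    pairOp α F₁ F₂ r ∈ Submodule.span ℝ (excLaguerre α F₁ F₂ '' sigmaSet F₁ F₂) := by
  rw [eq_sum_laguerre α r subset_rfl, map_sum]
  refine Submodule.sum_mem _ fun n _ => ?_
  rw [map_smul]
  refine Submodule.smul_mem _ _ ?_
  by_cases hn : n ∈ F₁
  · rw [pairOp_laguerre_of_mem hα hn]
    exact Submodule.zero_mem _
  · refine Submodule.subset_span ⟨uIndex F₁ F₂ + n, ⟨by omega, fun f hf h => hn ?_⟩, ?_⟩
    · rwa [show n = f by omega]
    · rw [excLaguerre_eq_pairOp, Nat.add_sub_cancel_left]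

end Pair

end ExcLaguerre
end

theorem theorem6p3 (α : ℝ) (hα : ∀ j : ℕ, α ≠ -((j : ℝ) + 1))
    (F₁ F₂ : Finset ℕ) (hF₁ : ∀ f ∈ F₁, 0 < f) (hF₂ : ∀ f ∈ F₂, 0 < f)
    (hF : F₁.Nonempty ∨ F₂.Nonempty)
    (hadm : ExcLaguerre.Admissible (α + 1) F₁ F₂) :
    (∀ x : ℝ, 0 < x →
      (ExcLaguerre.Omega α F₁ F₂).eval x ≠ 0 ∧ 0 < ExcLaguerre.weight α F₁ F₂ x) ∧
    ExcLaguerre.OrthogonalWrt (ExcLaguerre.weightMeasure α F₁ F₂)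
      (ExcLaguerre.sigmaSet F₁ F₂) (ExcLaguerre.excLaguerre α F₁ F₂) ∧
    ExcLaguerre.CompleteIn (ExcLaguerre.weightMeasure α F₁ F₂)
      (ExcLaguerre.sigmaSet F₁ F₂) (ExcLaguerre.excLaguerre α F₁ F₂) ∧
    ExcLaguerre.IsExceptionalLaguerre α F₁ F₂ := by
  have hk : 0 < F₁.card + F₂.card := by
    rcases hF with h | h
    · have := h.card_pos; omega
    · have := h.card_pos; omega
  have hΩ : ∀ x : ℝ, 0 ≤ x → (ExcLaguerre.Omega α F₁ F₂).eval x ≠ 0 := by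
    intro x hx
    rcases hx.eq_or_lt with rfl | hx
    · rw [← coeff_zero_eq_eval_zero]
      exact ExcLaguerre.coeff_zero_Omega_ne_zero hα
    · exact ExcLaguerre.eval_Omega_ne_zero hα hF₁ hk hadm hx
  have hβ := ExcLaguerre.neg_one_lt_of_admissible hα hF₁ hadm
  have hμ := ExcLaguerre.expSquareIntegrable_weightMeasure hΩ hβ
  have horth : ExcLaguerre.OrthogonalWrt (ExcLaguerre.weightMeasure α F₁ F₂)
      (ExcLaguerre.sigmaSet F₁ F₂) (ExcLaguerre.excLaguerre α F₁ F₂) := by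
    refine ⟨fun j => ?_, fun n hn m hm hnm => ?_, fun n hn => ?_⟩
    · simpa using ExcLaguerre.integrable_eval_weightMeasure hΩ hβ (X ^ j)
    · rw [ExcLaguerre.excLaguerre_eq_pairOp, ExcLaguerre.excLaguerre_eq_pairOp]
      have h1 := hn.1
      have h2 := hm.1
      exact ExcLaguerre.integral_pairOp_mul_pairOp hα hΩ hβ (by omega)
    · rw [ExcLaguerre.excLaguerre_eq_pairOp]
      refine ExcLaguerre.integral_eval_sq_pos hΩ hβ
        (ExcLaguerre.pairOp_laguerre_ne_zero hα fun h => hn.2 _ h ?_)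
      have h1 := hn.1
      omega
  have hcomp : ExcLaguerre.CompleteIn (ExcLaguerre.weightMeasure α F₁ F₂)
      (ExcLaguerre.sigmaSet F₁ F₂) (ExcLaguerre.excLaguerre α F₁ F₂) := by
    refine ⟨fun n _ => hμ.memLp _, ?_⟩
    -- The span contains every multiple of `Ω²`, and these are already dense.
    refine (ExcLaguerre.denseRange_polyLp_mul hμ
      (pow_ne_zero 2 (ExcLaguerre.Omega_ne_zero (F₁ := F₁) (F₂ := F₂) hα))).mono ?_
    rintro _ ⟨s, rfl⟩
    obtain ⟨r, hr⟩ := ExcLaguerre.exists_pairOp_eq (F₁ := F₁) (F₂ := F₂) hα s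
    refine ⟨_, ExcLaguerre.pairOp_mem_span hα r, ?_⟩
    rw [hr]
    exact ExcLaguerre.coeFn_polyLp hμ _
  exact ⟨fun x hx => ⟨hΩ x hx.le, ExcLaguerre.weight_pos hΩ hx⟩, horth, hcomp,
    _, horth, hcomp⟩
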